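/- For a real $Q$, integers $h,u\ge 1$, and complex weights $\alpha=(\alpha_n)$ with $|\alpha_n|\le 1$ for $u<n\le u+h$, put $$M_{2s}(Q;\alpha,u,h)=\sum_{\substack{p\in[Q,2Q]\\ p\ \mathrm{prime}}}\Bigl|\sum_{u<n\le u+h}\alpha_n\Bigl(\frac{n}{p}\Bigr)\Bigr|^{2s},$$ where $(\frac{n}{p})$ is the Legendre symbol. Let $R_{2s}(h,u)$ be the number of tuples $(n_1,\dots,n_{2s})$ of integers in $(u,u+h]$ whose product is a perfect square, and let $\pi(Q)$ be the number of primes not exceeding $Q$. For a fixed integer $s\ge1$, let $\mathcal C_s$ be the conjecture that $R_{2s}(h,u)\le h^{s+o(1)}$ for all integers $2\le h<u$, where $o(1)$ denotes a function of $h$ that tends to $0$ as $h\to\infty$ (uniformly over $u$). The Generalised Riemann Hypothesis (GRH) is the assertion that for every Dirichlet character $\chi$ all zeros of $L(s,\chi)$ with $0<\operatorname{Re}s<1$ satisfy $\operatorname{Re}s=1/2$. **Theorem.** Let $s\ge1$ be a fixed integer for which $\mathcal C_s$ holds, and assume the GRH. Then for all integers $h,u$ and real $Q$ with $2\le h<u\le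 Q$ and all weights $\alpha$ as above, $$M_{2s}(Q;\alpha,u,h)\le h^{s+o(1)}\,\pi(Q)+h^{2s}\,Q^{1/2+o(1)},$$ where the first $o(1)$ is a function of $h$ tending to $0$ as $h\to\infty$, the second is a function of $Q$ tending to $0$ as $Q\to\infty$, and both depend only on $s$ (they are uniform in $u$ and $\alpha$, the first also in $Q$ and the second also in $h$). Moreover, $\mathcal C_1$ holds, so that for $s=1$ the bound holds under the GRH alone. -/

import Mathlib

open Filter Topology

/-- The Generalised Riemann Hypothesis for Dirichlet `L`-functions: for every modulus `N ≥ 1` and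
every Dirichlet character `χ` modulo `N`, all zeros of `L(s, χ)` in the open critical strip
`0 < Re s < 1` lie on the line `Re s = 1/2`. -/
def GRH : Prop :=
  ∀ (N : ℕ) [NeZero N] (χ : DirichletCharacter ℂ N) (z : ℂ),
    χ.LFunction z = 0 → 0 < z.re → z.re < 1 → z.re = 1 / 2

/-- `R_k(h, u)`: the number of `k`-tuples of integers in `(u, u + h]` whose product is a square. -/
def squareTuples (k h u : ℕ) : ℕ :=
  ((Fintype.piFinset fun _ : Fin k => Finset.Ioc u (u + h)).filter
    fun n => IsSquare (∏ i, n i)).card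

/-- The conjecture on square products, for a fixed `s`: `R_{2s}(h, u) ≤ h ^ (s + o(1))` for all
integers `2 ≤ h < u`, where the `o(1)` is as `h → ∞`, uniformly over `u`. -/
def SquareProductConjecture (s : ℕ) : Prop :=
  ∃ δ : ℕ → ℝ, Tendsto δ atTop (𝓝 0) ∧
    ∀ h u : ℕ, 2 ≤ h → h < u →
      (squareTuples (2 * s) h u : ℝ) ≤ (h : ℝ) ^ ((s : ℝ) + δ h)

/-- The weighted sum of Legendre symbols `S_p(α, u, h) = ∑_{u < n ≤ u + h} α_n (n / p)`. -/
noncomputable def legendreSum (p : ℕ) [Fact p.Prime] (α : ℕ → ℂ) (u h : ℕ) : ℂ :=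
  ∑ n ∈ Finset.Ioc u (u + h), α n * (legendreSym p (n : ℤ) : ℂ)

/-- The finite set of primes in the real interval `[Q, 2Q]`. -/
noncomputable def dyadicPrimes (Q : ℝ) : Finset {p : ℕ // p.Prime} :=
  (Finset.Icc ⌈Q⌉₊ ⌊2 * Q⌋₊).subtype Nat.Prime

theorem mem_dyadicPrimes {Q : ℝ} {p : {p : ℕ // p.Prime}} :
    p ∈ dyadicPrimes Q ↔ Q ≤ ((p : ℕ) : ℝ) ∧ ((p : ℕ) : ℝ) ≤ 2 * Q := by
  have hp : (p : ℕ) ≠ 0 := p.2.ne_zero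
  unfold dyadicPrimes
  rw [Finset.mem_subtype, Finset.mem_Icc, Nat.ceil_le, Nat.le_floor_iff' hp]

/-- The moment `M_k(Q; α, u, h) = ∑_{p ∈ [Q, 2Q], p prime} |S_p(α, u, h)| ^ k`. -/
noncomputable def legendreMoment (k : ℕ) (Q : ℝ) (α : ℕ → ℂ) (u h : ℕ) : ℝ :=
  ∑ p ∈ dyadicPrimes Q,
    haveI : Fact (p : ℕ).Prime := ⟨p.2⟩
    ‖legendreSum (p : ℕ) α u h‖ ^ k

/-- `M_{2s}(Q; α, u, h) ≤ h ^ (s + o(1)) π(Q) + h ^ (2s) Q ^ (1/2 + o(1))` for all integers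
`h`, `u` and real `Q` with `2 ≤ h < u ≤ Q` and all complex weights with `|α_n| ≤ 1` on
`(u, u + h]`. The first `o(1)` is a function of `h` tending to `0` as `h → ∞`, the second one a
function of `Q` tending to `0` as `Q → ∞`; both depend on `s` only. -/
def MomentBound (s : ℕ) : Prop :=
  ∃ (δ : ℕ → ℝ) (η : ℝ → ℝ), Tendsto δ atTop (𝓝 0) ∧ Tendsto η atTop (𝓝 0) ∧
    ∀ (h u : ℕ) (Q : ℝ) (α : ℕ → ℂ), 2 ≤ h → h < u → (u : ℝ) ≤ Q →
      (∀ n ∈ Finset.Ioc u (u + h), ‖α n‖ ≤ 1) →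
      legendreMoment (2 * s) Q α u h ≤
        (h : ℝ) ^ ((s : ℝ) + δ h) * (Nat.primeCounting ⌊Q⌋₊ : ℝ)
          + (h : ℝ) ^ (2 * s) * Q ^ ((1 / 2 : ℝ) + η Q)

/-! Expand the $2s$-th power and sum over primes first: each tuple contributes a sum of Jacobi
symbols $(N/n)$ with $N=n_1\cdots n_{2s}$. If $N$ is a square, the sum is bounded trivially by
Chebyshev, and such tuples number $R_{2s}(h,u)$. Otherwise $n\mapsto(N/n)$ on odd $n$ is a
nonprincipal character mod $4N$, and GRH gives square-root cancellation, with only a factor $\log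
N\ll\log Q$ lost to the modulus.

The primes of $[Q,2Q]$ are detected by the positive weight $\Lambda(n)e^{-\log^2(Q/n)/2}$ over all
odd $n$; positivity lets the moment be enlarged to this smooth sum. The weight is the Mellin inverse
of a Gaussian, so the character sum is an integral of $-L'/L$ against $e^{z^2/2}Q^z$ on
$\operatorname{Re}z=2$, which GRH allows to be moved to $\operatorname{Re}z=1/2+\varepsilon$ with no
residues (`integral_mul_gaussKernel_eq`, `GRH.exists_norm_tsum_vonMangoldt_le`). Gaussian decay
tolerates a crude bound for $L'/L$, linear in the height, obtained from Borel–Carathéodory on a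
zero-free disc (`norm_deriv_div_le_of_norm_le_exp_mul`). The factor $\log p$ in the weight cancels
the loss $\log Q$, and letting $\varepsilon\to0$ slowly with $Q$ gives the $o(1)$ in the exponent.

For $s=1$, $mn$ is a square exactly when $m=ga^2$, $n=gb^2$; then $g(b-a)(b+a)=n-m<h$, so
off-diagonal pairs are counted by a divisor-type sum independent of $u$. -/

/-! ### Pairs with square product: the case $s=1$ of the conjecture -/

/-- The number of triples of positive integers with product at most `h`. -/
theorem card_mul_mul_le_le (h : ℕ) (hh : 1 ≤ h) :
    ((((Finset.Icc 1 h ×ˢ Finset.Icc 1 h ×ˢ Finset.Icc 1 h).filter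
      fun t : ℕ × ℕ × ℕ => t.1 * t.2.1 * t.2.2 ≤ h).card : ℕ) : ℝ) ≤ h * (1 + Real.log h) ^ 2 := by
  have key : ((Finset.Icc 1 h ×ˢ Finset.Icc 1 h ×ˢ Finset.Icc 1 h).filter
      fun t : ℕ × ℕ × ℕ => t.1 * t.2.1 * t.2.2 ≤ h).card ≤
      ∑ d ∈ Finset.Icc 1 h, ∑ x ∈ Finset.Icc 1 h, h / (d * x) := by
    rw [Finset.card_filter, Finset.sum_product]
    refine Finset.sum_le_sum fun d hd => ?_
    rw [Finset.sum_product]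
    refine Finset.sum_le_sum fun x hx => ?_
    simp only [Finset.mem_Icc] at hd hx
    rw [← Finset.card_filter]
    have hdx : 0 < d * x := Nat.mul_pos hd.1 hx.1
    calc _ ≤ (Finset.Icc 1 (h / (d * x))).card := by
          refine Finset.card_le_card fun y hy => ?_
          simp only [Finset.mem_filter, Finset.mem_Icc] at hy ⊢
          refine ⟨hy.1.1, (Nat.le_div_iff_mul_le hdx).2 ?_⟩
          rw [mul_comm]; exact hy.2
      _ = _ := by simp
  have hH : (∑ d ∈ Finset.Icc 1 h, (1 / (d : ℝ))) ≤ 1 + Real.log h := by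
    have := harmonic_le_one_add_log h
    rw [harmonic_eq_sum_Icc] at this
    push_cast at this
    simpa using this
  have hH0 : 0 ≤ ∑ d ∈ Finset.Icc 1 h, (1 / (d : ℝ)) := Finset.sum_nonneg fun _ _ => by positivity
  calc _ ≤ ((∑ d ∈ Finset.Icc 1 h, ∑ x ∈ Finset.Icc 1 h, h / (d * x) : ℕ) : ℝ) := by
        exact_mod_cast key
    _ ≤ ∑ d ∈ Finset.Icc 1 h, ∑ x ∈ Finset.Icc 1 h, (h : ℝ) * ((1 / d) * (1 / x)) := by
        push_cast
        refine Finset.sum_le_sum fun d _ => Finset.sum_le_sum fun x _ => ?_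
        refine (Nat.cast_div_le).trans (le_of_eq ?_)
        push_cast
        rw [one_div_mul_one_div, mul_one_div]
    _ = h * (∑ d ∈ Finset.Icc 1 h, (1 / (d : ℝ))) ^ 2 := by
        rw [sq, Finset.sum_mul_sum, Finset.mul_sum]
        exact Finset.sum_congr rfl fun _ _ => by rw [Finset.mul_sum]
    _ ≤ _ := by gcongr

/-- After division by the gcd, the coprime cofactors have a square product, so each is a square. -/
theorem exists_eq_mul_sq_of_isSquare_mul {m n : ℕ} (hm : 0 < m) (hn : 0 < n)
    (hsq : IsSquare (m * n)) : ∃ g a b : ℕ, 0 < g ∧ 0 < a ∧ 0 < b ∧ m = g * a ^ 2 ∧ n = g * b ^ 2 := by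
  obtain ⟨g, m', n', hg, hco, rfl, rfl⟩ := Nat.exists_coprime' (m := m) (n := n)
    (Nat.gcd_pos_of_pos_left n hm)
  obtain ⟨c, hc⟩ := hsq
  have hdvd : g ∣ c := by
    rw [← Nat.pow_dvd_pow_iff (n := 2) two_ne_zero, pow_two c, ← hc]
    exact ⟨m' * n', by ring⟩
  obtain ⟨k, rfl⟩ := hdvd
  have hk : m' * n' = k ^ 2 := by
    have : g ^ 2 * (m' * n') = g ^ 2 * k ^ 2 := by linarith [hc]
    exact Nat.eq_of_mul_eq_mul_left (by positivity) this
  have hco' : IsUnit (gcd m' n') := by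
    rw [Nat.isUnit_iff]; exact hco
  obtain ⟨a, ha⟩ := exists_eq_pow_of_mul_eq_pow hco' hk
  obtain ⟨b, hb⟩ := exists_eq_pow_of_mul_eq_pow (a := n') (b := m') (k := 2) (c := k)
    (by rw [gcd_comm]; exact hco') (by rw [mul_comm]; exact hk)
  subst ha hb
  refine ⟨g, a, b, hg, ?_, ?_, mul_comm _ _, mul_comm _ _⟩
  · rcases Nat.eq_zero_or_pos a with rfl | h
    · simp at hm
    · exact h
  · rcases Nat.eq_zero_or_pos b with rfl | h
    · simp at hn
    · exact h

/-- Pairs `m < n` in an interval of length `h` with `m * n` a square. -/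
theorem card_lt_square_pairs_le (h u : ℕ) :
    ((Finset.Ioc u (u + h) ×ˢ Finset.Ioc u (u + h)).filter
      fun p : ℕ × ℕ => p.1 < p.2 ∧ IsSquare (p.1 * p.2)).card ≤
    ((Finset.Icc 1 h ×ˢ Finset.Icc 1 h ×ˢ Finset.Icc 1 h).filter
      fun t : ℕ × ℕ × ℕ => t.1 * t.2.1 * t.2.2 ≤ h).card := by
  classical
  -- With $m=ga^2$, $n=gb^2$, the triple is $(g,b-a,a+b)$; the map recovers $a$ and $b$ by halving
  -- the difference and the sum of its last two entries.
  refine Finset.card_le_card_of_surjOn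
    (fun t : ℕ × ℕ × ℕ => (t.1 * ((t.2.2 - t.2.1) / 2) ^ 2, t.1 * ((t.2.1 + t.2.2) / 2) ^ 2)) ?_
  rintro ⟨m, n⟩ hmn
  simp only [Finset.coe_filter, Finset.mem_product, Finset.mem_Ioc, Set.mem_ofPred_eq] at hmn
  obtain ⟨⟨⟨h1, h2⟩, h3, h4⟩, hlt, hsq⟩ := hmn
  obtain ⟨g, a, b, hg, ha, hb, rfl, rfl⟩ :=
    exists_eq_mul_sq_of_isSquare_mul (by omega) (by omega) hsq
  have hab : a < b := by
    have := Nat.lt_of_mul_lt_mul_left hlt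
    exact lt_of_pow_lt_pow_left₀ 2 (by omega) this
  obtain ⟨d, rfl⟩ := Nat.exists_eq_add_of_lt hab
  have hle : g * (d + 1) * (2 * a + d + 1) ≤ h := by
    have : g * (a + d + 1) ^ 2 = g * a ^ 2 + g * (d + 1) * (2 * a + d + 1) := by ring
    omega
  refine ⟨(g, d + 1, 2 * a + d + 1), ?_, ?_⟩
  · have h5 : 1 ≤ g * (d + 1) := Nat.mul_pos hg (by omega)
    have h6 : g ≤ g * (d + 1) := Nat.le_mul_of_pos_right _ (by omega)
    have h7 : d + 1 ≤ g * (d + 1) := Nat.le_mul_of_pos_left _ hg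
    have h8 : g * (d + 1) ≤ g * (d + 1) * (2 * a + d + 1) := Nat.le_mul_of_pos_right _ (by omega)
    have h9 : 2 * a + d + 1 ≤ g * (d + 1) * (2 * a + d + 1) := Nat.le_mul_of_pos_left _ h5
    simp only [Finset.coe_filter, Finset.mem_product, Finset.mem_Icc, Set.mem_ofPred_eq]
    refine ⟨⟨⟨hg, by omega⟩, ⟨by omega, by omega⟩, by omega, by omega⟩, hle⟩
  · have e1 : (2 * a + d + 1 - (d + 1)) / 2 = a := by omega
    have e2 : (d + 1 + (2 * a + d + 1)) / 2 = a + d + 1 := by omega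
    simp only [e1, e2]

theorem squareTuples_two_le (h u : ℕ) (hh : 1 ≤ h) :
    (squareTuples (2 * 1) h u : ℝ) ≤ 3 * h * (1 + Real.log h) ^ 2 := by
  classical
  set I := Finset.Ioc u (u + h) with hI
  set A := (I ×ˢ I).filter fun p : ℕ × ℕ => p.1 < p.2 ∧ IsSquare (p.1 * p.2) with hA
  have h1 : squareTuples (2 * 1) h u ≤ h + 2 * A.card := by
    have hs : squareTuples (2 * 1) h u ≤
        ((I.image fun n => (n, n)) ∪ (A ∪ A.image Prod.swap)).card := by
      refine Finset.card_le_card_of_injOn (fun n => (n 0, n 1)) ?_ ?_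
      · intro n hn
        simp only [Finset.coe_filter, Fintype.mem_piFinset, Set.mem_ofPred_eq] at hn
        obtain ⟨hn, hsq⟩ := hn
        have hsq' : IsSquare (n 0 * n 1) := by
          have : ∏ i, n i = n 0 * n 1 := Fin.prod_univ_two n
          rwa [this] at hsq
        have e0 := hn 0
        have e1 := hn 1
        simp only [Finset.coe_union, Finset.coe_image, Set.mem_union, Set.mem_image,
          Finset.mem_coe, hA, Finset.mem_filter, Finset.mem_product, Prod.exists]
        rcases lt_trichotomy (n 0) (n 1) with hlt | heq | hgt
        · exact Or.inr (Or.inl ⟨⟨e0, e1⟩, hlt, hsq'⟩)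
        · exact Or.inl ⟨n 0, e0, by rw [← heq]⟩
        · exact Or.inr (Or.inr ⟨n 1, n 0, ⟨⟨e1, e0⟩, hgt, by rwa [mul_comm]⟩, rfl⟩)
      · intro m _ n _ hmn
        simp only [Prod.mk.injEq] at hmn
        funext i
        have : ∀ i : Fin 2, m i = n i := by
          intro i
          fin_cases i
          · exact hmn.1
          · exact hmn.2
        exact this i
    refine hs.trans ((Finset.card_union_le _ _).trans ?_)
    have c1 : (I.image fun n => (n, n)).card ≤ h :=
      Finset.card_image_le.trans (by simp [hI])
    have c2 : (A ∪ A.image Prod.swap).card ≤ 2 * A.card :=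
      (Finset.card_union_le _ _).trans (by
        have := Finset.card_image_le (s := A) (f := Prod.swap)
        omega)
    omega
  have h2 : (A.card : ℝ) ≤ h * (1 + Real.log h) ^ 2 :=
    le_trans (by exact_mod_cast card_lt_square_pairs_le h u) (card_mul_mul_le_le h hh)
  have hl : 0 ≤ Real.log h := Real.log_natCast_nonneg h
  have h3 : (h : ℝ) ≤ h * (1 + Real.log h) ^ 2 :=
    le_mul_of_one_le_right (by positivity) (one_le_pow₀ (by linarith))
  calc (squareTuples (2 * 1) h u : ℝ) ≤ h + 2 * A.card := by exact_mod_cast h1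
    _ ≤ _ := by linarith

/-- This quotient is the $\delta$ solving $h^{\delta}=3(1+\log h)^2$, the loss in
`squareTuples_two_le`. -/
theorem tendsto_log_one_add_log_div_log :
    Tendsto (fun h : ℕ => (Real.log 3 + 2 * Real.log (1 + Real.log h)) / Real.log h) atTop (𝓝 0) := by
  have hl : Tendsto (fun h : ℕ => Real.log h) atTop atTop :=
    Real.tendsto_log_atTop.comp tendsto_natCast_atTop_atTop
  have key : Tendsto (fun x : ℝ => (Real.log 3 + 2 * Real.log (1 + x)) / x) atTop (𝓝 0) := by
    have h1 : Tendsto (fun x : ℝ => Real.log (1 + x) / (1 + x)) atTop (𝓝 0) :=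
      (Real.isLittleO_log_id_atTop.tendsto_div_nhds_zero).comp (tendsto_atTop_add_const_left _ 1 tendsto_id)
    have h2 : Tendsto (fun x : ℝ => x⁻¹) atTop (𝓝 0) := tendsto_inv_atTop_zero
    have h3 : Tendsto (fun x : ℝ => Real.log 3 * x⁻¹ + 2 * (Real.log (1 + x) / (1 + x)) * (x⁻¹ + 1))
        atTop (𝓝 (Real.log 3 * 0 + 2 * 0 * (0 + 1))) :=
      (h2.const_mul _).add ((h1.const_mul 2).mul (h2.add_const 1))
    simp only [mul_zero, zero_mul, add_zero] at h3
    refine h3.congr' ?_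
    filter_upwards [eventually_gt_atTop 0] with x hx
    field_simp
  exact key.comp hl

theorem squareProductConjecture_one : SquareProductConjecture 1 := by
  refine ⟨_, tendsto_log_one_add_log_div_log, fun h u hh _ => ?_⟩
  have hh' : (2 : ℝ) ≤ h := by exact_mod_cast hh
  have hl : 0 < Real.log h := Real.log_pos (by linarith)
  refine (squareTuples_two_le h u (by omega)).trans (le_of_eq ?_)
  rw [Nat.cast_one, Real.rpow_add (by linarith), Real.rpow_one,
    Real.rpow_def_of_pos (by linarith : (0 : ℝ) < h), mul_div_cancel₀ _ hl.ne', Real.exp_add,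
    Real.exp_log (by norm_num), two_mul, Real.exp_add, Real.exp_log (by linarith)]
  ring

/-! ### The quadratic character $n\mapsto(N/n)$ modulo $4N$ -/

open scoped NumberTheorySymbols in
theorem jacobiSym_mod_four_mul (N : ℕ) {n : ℕ} (hn : Odd n) :
    Odd (n % (4 * N)) ∧ J(N | n % (4 * N)) = J(N | n) := by
  refine ⟨?_, (jacobiSym.mod_right' N hn).symm⟩
  rw [Nat.odd_iff] at hn ⊢
  rw [Nat.mod_mod_of_dvd _ (Dvd.intro (2 * N) (by ring)), hn]

theorem not_odd_mod_four_mul (N : ℕ) {n : ℕ} (hn : ¬ Odd n) : ¬ Odd (n % (4 * N)) := by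
  rw [Nat.odd_iff] at hn ⊢
  rwa [Nat.mod_mod_of_dvd _ (Dvd.intro (2 * N) (by ring))]

/-- The Dirichlet character modulo `4 * N` given by `n ↦ (N / n)` for odd `n`. -/
noncomputable def jacobiChar (N : ℕ) [NeZero N] : DirichletCharacter ℂ (4 * N) where
  toFun x := if Odd x.val then (jacobiSym N x.val : ℂ) else 0
  map_one' := by
    have : Fact (1 < 4 * N) := ⟨by have := NeZero.pos N; omega⟩
    simp [ZMod.val_one]
  map_mul' x y := by
    have hxy : (x * y).val = (x.val * y.val) % (4 * N) := ZMod.val_mul x y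
    simp only [hxy]
    by_cases h : Odd (x.val * y.val)
    · obtain ⟨h1, h2⟩ := jacobiSym_mod_four_mul N h
      obtain ⟨hx, hy⟩ := Nat.odd_mul.1 h
      rw [if_pos h1, if_pos hx, if_pos hy, h2,
        jacobiSym.mul_right' _ (Nat.ne_of_odd_add (by simpa using hx))
          (Nat.ne_of_odd_add (by simpa using hy))]
      push_cast
      ring
    · rw [if_neg (not_odd_mod_four_mul N h)]
      rw [Nat.odd_mul, not_and_or] at h
      rcases h with h | h <;> simp [h]
  map_nonunit' x hx := by
    by_cases h : Odd x.val
    · rw [if_pos h, Int.cast_eq_zero, jacobiSym.eq_zero_iff]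
      refine ⟨Nat.ne_of_odd_add (by simpa using h), fun hco => hx ?_⟩
      rw [← ZMod.natCast_zmod_val x, ZMod.isUnit_iff_coprime]
      refine Nat.Coprime.mul_right ?_ (Nat.Coprime.symm ?_)
      · exact Nat.Coprime.pow_right 2 (Nat.coprime_two_right.2 h)
      · rwa [Int.gcd_natCast_natCast] at hco
    · rw [if_neg h]

theorem jacobiChar_apply_of_odd (N : ℕ) [NeZero N] {n : ℕ} (hn : Odd n) :
    jacobiChar N (n : ZMod (4 * N)) = (jacobiSym N n : ℂ) := by
  obtain ⟨h1, h2⟩ := jacobiSym_mod_four_mul N hn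
  change (if Odd (n : ZMod (4 * N)).val then (jacobiSym N (n : ZMod (4 * N)).val : ℂ) else 0) = _
  rw [ZMod.val_natCast, if_pos h1, h2]

theorem jacobiChar_apply_of_not_odd (N : ℕ) [NeZero N] {n : ℕ} (hn : ¬ Odd n) :
    jacobiChar N (n : ZMod (4 * N)) = 0 := by
  change (if Odd (n : ZMod (4 * N)).val then (jacobiSym N (n : ZMod (4 * N)).val : ℂ) else 0) = _
  rw [ZMod.val_natCast, if_neg (not_odd_mod_four_mul N hn)]

theorem exists_prime_odd_factorization_of_not_isSquare {N : ℕ} (hN : N ≠ 0) (h : ¬ IsSquare N) :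
    ∃ ℓ a k : ℕ, ℓ.Prime ∧ N = a * ℓ ^ k ∧ Odd k ∧ ¬ ℓ ∣ a := by
  by_contra! hcon
  refine h ?_
  have heven : ∀ p : ℕ, p.Prime → Even (N.factorization p) := by
    intro p hp
    by_contra hodd
    rw [Nat.not_even_iff_odd] at hodd
    refine Nat.not_dvd_ordCompl hp hN (hcon p (ordCompl[p] N) (N.factorization p) hp ?_ hodd)
    rw [mul_comm]; exact (Nat.ordProj_mul_ordCompl_eq_self N p).symm
  rw [← Nat.prod_factorization_pow_eq_self hN]
  refine Finset.isSquare_prod _ fun p hp => ?_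
  exact (heven p (Nat.prime_of_mem_primeFactors (by simpa using hp))).isSquare_pow _

/-- For a prime `ℓ` not dividing `a`, there is an odd `n` with `(a / n) = 1` and `(ℓ / n) = -1`. -/
theorem exists_odd_jacobiSym_eq_one_eq_neg_one {ℓ a : ℕ} (hℓ : ℓ.Prime) (ha : ¬ ℓ ∣ a) :
    ∃ n : ℕ, Odd n ∧ jacobiSym a n = 1 ∧ jacobiSym ℓ n = -1 := by
  have hco : Nat.Coprime ℓ a := (Nat.Prime.coprime_iff_not_dvd hℓ).2 ha
  rcases hℓ.eq_two_or_odd' with rfl | hodd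
  · have ha' : Odd a := Nat.coprime_two_left.1 hco
    -- The class $5$ mod $8$ makes $2$ a nonresidue and is $1$ mod $4$, so reciprocity gives
    -- $(a/n)=(n/a)=1$ without a sign.
    obtain ⟨n, h8, h1⟩ := Nat.chineseRemainder (Nat.Coprime.pow_left 3 hco) 5 1
    have h8' : n % 8 = 5 := h8
    have hn : Odd n := Nat.odd_iff.2 (by omega)
    refine ⟨n, hn, ?_, ?_⟩
    · rw [jacobiSym.quadratic_reciprocity_one_mod_four' ha' (by omega),
        jacobiSym.mod_left' (a₂ := 1) (by exact_mod_cast h1), jacobiSym.one_left]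
    · have := jacobiSym.at_two hn
      rw [Nat.cast_two, this, ZMod.χ₈_nat_eq_if_mod_eight]
      omega
  · have := Fact.mk hℓ
    have hℓ2 : ringChar (ZMod ℓ) ≠ 2 := by
      rw [ZMod.ringChar_zmod_n]
      rintro rfl
      exact absurd hodd (by decide)
    obtain ⟨r, hr⟩ := quadraticChar_exists_neg_one hℓ2
    have hco' : Nat.Coprime ℓ (4 * a) :=
      Nat.Coprime.mul_right (Nat.Coprime.pow_right 2 (Nat.coprime_two_right.2 hodd)) hco
    -- Since $n\equiv1$ mod $4a$, $(a/n)=(a/1)=1$ and reciprocity has no sign, so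
    -- $(\ell/n)=(n/\ell)=(r/\ell)=-1$.
    obtain ⟨n, hr', h1⟩ := Nat.chineseRemainder hco' r.val 1
    have h4 : n % 4 = 1 := Nat.ModEq.of_mul_right a h1
    have hn : Odd n := Nat.odd_iff.2 (by omega)
    refine ⟨n, hn, ?_, ?_⟩
    · rw [jacobiSym.mod_right' a hn, show n % (4 * a) = 1 % (4 * a) from h1,
        ← jacobiSym.mod_right' a odd_one, jacobiSym.one_right]
    · rw [jacobiSym.quadratic_reciprocity_one_mod_four' hodd h4, ← jacobiSym.legendreSym.to_jacobiSym,
        legendreSym]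
      rw [← hr]
      congr 1
      rw [Int.cast_natCast, ← ZMod.natCast_zmod_val r]
      exact (ZMod.natCast_eq_natCast_iff _ _ _).2 hr'

/-- Write $N=a\ell^k$ with $k$ odd and $\ell\nmid a$; choosing $(a/n)=1$ and $(\ell/n)=-1$ forces
the value $(-1)^k=-1$. -/
theorem jacobiChar_ne_one {N : ℕ} [NeZero N] (h : ¬ IsSquare N) : jacobiChar N ≠ 1 := by
  obtain ⟨ℓ, a, k, hℓ, hN, hk, ha⟩ :=
    exists_prime_odd_factorization_of_not_isSquare (NeZero.ne N) h
  obtain ⟨n, hn, h1, h2⟩ := exists_odd_jacobiSym_eq_one_eq_neg_one hℓ ha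
  have hval : jacobiChar N (n : ZMod (4 * N)) = -1 := by
    rw [jacobiChar_apply_of_odd N hn]
    have : jacobiSym N n = -1 := by
      rw [hN]
      push_cast
      rw [jacobiSym.mul_left, jacobiSym.pow_left, h1, h2, one_mul, hk.neg_one_pow]
    rw [this]
    simp
  intro heq
  rw [heq] at hval
  by_cases hu : IsUnit (n : ZMod (4 * N))
  · rw [MulChar.one_apply hu] at hval
    norm_num at hval
  · rw [MulChar.map_nonunit _ hu] at hval
    norm_num at hval

/-! ### Growth of $L(s,\chi)$ for $\operatorname{Re}s>0$ -/

theorem sum_range_natCast_eq_sum_zmod {q : ℕ} [NeZero q] (f : ZMod q → ℂ) :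
    ∑ k ∈ Finset.range q, f k = ∑ x, f x :=
  Finset.sum_nbij' (fun k => (k : ZMod q)) ZMod.val (by simp)
    (fun x _ => by simpa using ZMod.val_lt x)
    (fun k hk => ZMod.val_cast_of_lt (by simpa using hk)) (by simp) (by simp)

/-- A complete period sums to zero, so partial sums are periodic mod $q$ and have at most $q$ terms
after reduction. -/
theorem norm_sum_Icc_dirichletCharacter_le {q : ℕ} [NeZero q] {χ : DirichletCharacter ℂ q}
    (hχ : χ ≠ 1) (n : ℕ) : ‖∑ k ∈ Finset.Icc 1 n, χ k‖ ≤ q := by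
  set g : ℕ → ℂ := fun n => ∑ k ∈ Finset.range n, χ ((k + 1 : ℕ) : ZMod q) with hg
  have hper : Function.Periodic g q := by
    intro n
    simp only [hg, Finset.sum_range_add, add_eq_left]
    have := sum_range_natCast_eq_sum_zmod fun x : ZMod q => χ ((n + 1 : ZMod q) + x)
    have h2 : ∑ x : ZMod q, χ ((n + 1 : ZMod q) + x) = 0 :=
      (Fintype.sum_equiv (Equiv.addLeft (n + 1 : ZMod q)) _ (fun x => χ x) fun _ => rfl).trans
        (MulChar.sum_eq_zero_of_ne_one hχ)
    rw [h2] at this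
    rw [← this]
    refine Finset.sum_congr rfl fun k _ => ?_
    push_cast
    ring_nf
  have hgn : ∑ k ∈ Finset.Icc 1 n, χ k = g n := by
    simp only [hg]
    rw [Finset.range_eq_Ico, Finset.sum_Ico_add' (fun k : ℕ => χ (k : ZMod q)) 0 n 1]
    rfl
  rw [hgn, ← hper.map_mod_nat n]
  refine (norm_sum_le _ _).trans ((Finset.sum_le_card_nsmul _ _ 1 fun k _ => χ.norm_le_one _).trans ?_)
  simpa using (Nat.mod_lt n (NeZero.pos q)).le

section BoundedPartialSums

variable {a : ℕ → ℂ} {B : ℝ}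

theorem mellin_partialSums_eq (a : ℕ → ℂ) (s : ℂ) :
    mellin (fun t : ℝ => ∑ k ∈ Finset.Icc 1 ⌊t⌋₊, a k) (-s) =
      ∫ t in Set.Ioi (1 : ℝ), (∑ k ∈ Finset.Icc 1 ⌊t⌋₊, a k) * (t : ℂ) ^ (-(s + 1)) := by
  rw [mellin, ← MeasureTheory.integral_Ici_eq_integral_Ioi (x := (1 : ℝ)),
     MeasureTheory.setIntegral_eq_of_subset_of_forall_sdiff_eq_zero measurableSet_Ioi
      (Set.Ici_subset_Ioi.2 one_pos)]
  · refine MeasureTheory.setIntegral_congr_fun measurableSet_Ici fun t _ => ?_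
    simp only [smul_eq_mul]
    rw [mul_comm, neg_add']
  · intro t ht
    have : ⌊t⌋₊ = 0 := Nat.floor_eq_zero.2 (not_le.1 ht.2)
    simp [this]

theorem differentiableAt_mul_mellin_partialSums
    (ha : ∀ n, ‖∑ k ∈ Finset.Icc 1 n, a k‖ ≤ B) {s : ℂ} (hs : 0 < s.re) :
    DifferentiableAt ℂ
      (fun s => s * mellin (fun t : ℝ => ∑ k ∈ Finset.Icc 1 ⌊t⌋₊, a k) (-s)) s := by
  have hm : Measurable fun t : ℝ => ∑ k ∈ Finset.Icc 1 ⌊t⌋₊, a k :=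
    (measurable_of_countable fun n : ℕ => ∑ k ∈ Finset.Icc 1 n, a k).comp Nat.measurable_floor
  -- The partial sums are bounded at infinity (exponent $0$) and vanish on $(0,1)$, so any exponent
  -- below $\operatorname{Re}(-s)$ serves as `b`.
  have h := mellin_differentiableAt_of_isBigO_rpow
    (f := fun t : ℝ => ∑ k ∈ Finset.Icc 1 ⌊t⌋₊, a k) (a := 0) (b := -s.re - 1) (s := -s)
    ?_ ?_ (by simpa using hs) ?_ (by simp)
  · exact differentiableAt_id.mul (h.comp s differentiableAt_id.neg)
  · refine MeasureTheory.LocallyIntegrable.locallyIntegrableOn ?_ _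
    refine (MeasureTheory.locallyIntegrable_const (B : ℝ)).mono hm.aestronglyMeasurable ?_
    exact Eventually.of_forall fun t => (ha _).trans (le_abs_self B)
  · refine Asymptotics.IsBigO.of_bound B (Eventually.of_forall fun t => ?_)
    simpa using ha ⌊t⌋₊
  · refine Asymptotics.IsBigO.of_bound 0 ?_
    filter_upwards [Ioo_mem_nhdsGT (zero_lt_one (α := ℝ))] with t ht
    have : ⌊t⌋₊ = 0 := Nat.floor_eq_zero.2 ht.2
    simp [this]

theorem norm_mul_mellin_partialSums_le
    (ha : ∀ n, ‖∑ k ∈ Finset.Icc 1 n, a k‖ ≤ B) {s : ℂ} (hs : 0 < s.re) :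
    ‖s * mellin (fun t : ℝ => ∑ k ∈ Finset.Icc 1 ⌊t⌋₊, a k) (-s)‖ ≤ B * ‖s‖ / s.re := by
  rw [mellin_partialSums_eq, norm_mul]
  have hint : MeasureTheory.IntegrableOn (fun t : ℝ => B * t ^ (-(s.re + 1))) (Set.Ioi 1) :=
    (integrableOn_Ioi_rpow_of_lt (by linarith) one_pos).const_mul B
  have h := MeasureTheory.norm_integral_le_of_norm_le hint
    (f := fun t : ℝ => (∑ k ∈ Finset.Icc 1 ⌊t⌋₊, a k) * (t : ℂ) ^ (-(s + 1))) (by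
      refine (MeasureTheory.ae_restrict_iff' measurableSet_Ioi).2 (Eventually.of_forall fun t ht => ?_)
      have ht0 : 0 < t := one_pos.trans ht
      rw [norm_mul, Complex.norm_cpow_eq_rpow_re_of_pos ht0]
      simp only [Complex.neg_re, Complex.add_re, Complex.one_re]
      gcongr
      exact ha _)
  rw [MeasureTheory.integral_const_mul, integral_Ioi_rpow_of_lt (by linarith) one_pos,
    Real.one_rpow] at h
  calc _ ≤ ‖s‖ * (B * (-1 / (-(s.re + 1) + 1))) := by gcongr
    _ = _ := by
      rw [show -(s.re + 1) + 1 = -s.re by ring, neg_div_neg_eq]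
      ring

end BoundedPartialSums

/-- Abel summation gives $L(s,\chi)=s\int_1^\infty S(t)t^{-s-1}\,dt$ for $\operatorname{Re}s>1$.
Both sides are analytic for $\operatorname{Re}s>0$, so the identity persists there, and $|S|\le q$.
Primitivity of $\chi$ plays no role. -/
theorem norm_LFunction_le {q : ℕ} [NeZero q] {χ : DirichletCharacter ℂ q} (hχ : χ ≠ 1) {s : ℂ}
    (hs : 0 < s.re) : ‖χ.LFunction s‖ ≤ q * ‖s‖ / s.re := by
  set G : ℂ → ℂ := fun s => s * mellin (fun t : ℝ => ∑ k ∈ Finset.Icc 1 ⌊t⌋₊, χ k) (-s) with hG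
  have hB := norm_sum_Icc_dirichletCharacter_le hχ
  have hopen : IsOpen {s : ℂ | 0 < s.re} := isOpen_lt continuous_const Complex.continuous_re
  have hG' : AnalyticOnNhd ℂ G {s : ℂ | 0 < s.re} :=
    DifferentiableOn.analyticOnNhd (fun s hs =>
      (differentiableAt_mul_mellin_partialSums hB hs).differentiableWithinAt) hopen
  have hL : AnalyticOnNhd ℂ χ.LFunction {s : ℂ | 0 < s.re} :=
    (DirichletCharacter.differentiable_LFunction hχ).differentiableOn.analyticOnNhd hopen
  have heq : χ.LFunction =ᶠ[𝓝 2] G := by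
    have : {s : ℂ | 1 < s.re} ∈ 𝓝 (2 : ℂ) :=
      (isOpen_lt continuous_const Complex.continuous_re).mem_nhds (by simp)
    filter_upwards [this] with z hz
    have hz' : 1 < z.re := hz
    rw [DirichletCharacter.LFunction_eq_LSeries χ hz', hG]
    simp only
    rw [mellin_partialSums_eq]
    refine LSeries_eq_mul_integral _ le_rfl (by linarith)
      (DirichletCharacter.LSeriesSummable_of_one_lt_re χ hz') ?_
    refine Asymptotics.IsBigO.of_bound q (Eventually.of_forall fun n => ?_)
    simpa using hB n
  have hpre : IsPreconnected {s : ℂ | 0 < s.re} := (convex_halfSpace_re_gt 0).isPreconnected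
  rw [hL.eqOn_of_preconnected_of_eventuallyEq hG' hpre (z₀ := 2) (by simp) heq hs]
  exact norm_mul_mellin_partialSums_le hB hs

/-! ### The logarithmic derivative under GRH -/

/-- On a zero-free disc $f=f(c)e^{g}$ with $g(c)=0$ and $\operatorname{Re}g\le M$.
Borel–Carathéodory bounds $g$ on the disc of middle radius $(R+r)/2$, and Cauchy's estimate on a
circle of radius $(R-r)/2$ about $z$ bounds $g'=f'/f$. -/
theorem norm_deriv_div_le_of_norm_le_exp_mul {f : ℂ → ℂ} {c z : ℂ} {R r M : ℝ} (hr : 0 ≤ r) (hrR : r < R)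
    (hM : 0 < M) (hf : DifferentiableOn ℂ f (Metric.ball c R))
    (h0 : ∀ w ∈ Metric.ball c R, f w ≠ 0)
    (hb : ∀ w ∈ Metric.ball c R, ‖f w‖ ≤ Real.exp M * ‖f c‖) (hz : dist z c ≤ r) :
    ‖deriv f z / f z‖ ≤ 4 * M * (R + r) / (R - r) ^ 2 := by
  have hopen : IsOpen (Metric.ball c R) := Metric.isOpen_ball
  have hcR : c ∈ Metric.ball c R := Metric.mem_ball_self (hr.trans_lt hrR)
  have hzR : z ∈ Metric.ball c R := hz.trans_lt hrR
  obtain ⟨g, hgc, hg⟩ := ((hf.deriv hopen).div hf h0).isExactOn_ball.with_val_at c 0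
  have hgd : DifferentiableOn ℂ g (Metric.ball c R) := fun w hw =>
    (hg w hw).differentiableAt.differentiableWithinAt
  have hfw : ∀ w ∈ Metric.ball c R, f w = f c * Complex.exp (g w) := by
    intro w hw
    have hconst := hopen.is_const_of_deriv_eq_zero (Metric.isPreconnected_ball)
      (f := fun w => f w * Complex.exp (-g w)) (hf.mul hgd.neg.cexp) (fun w hw => by
        have h1 : HasDerivAt f (deriv f w) w :=
          (hf.differentiableAt (hopen.mem_nhds hw)).hasDerivAt
        have h2 := h1.mul (hg w hw).neg.cexp
        rw [HasDerivAt.deriv (f := fun w => f w * Complex.exp (-g w)) h2]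
        have := h0 w hw
        simp only [Pi.div_apply, Pi.zero_apply]
        field_simp
        ring) hw hcR
    simp only [hgc, neg_zero, Complex.exp_zero, mul_one] at hconst
    rw [← hconst, mul_assoc, ← Complex.exp_add]
    simp
  have hre : ∀ w ∈ Metric.ball c R, (g w).re ≤ M := by
    intro w hw
    have h1 := hb w hw
    rw [hfw w hw, norm_mul, Complex.norm_exp, mul_comm] at h1
    exact Real.exp_le_exp.1 (le_of_mul_le_mul_right h1 (norm_pos_iff.2 (h0 c hcR)))
  set R' := (R + r) / 2 with hR'
  have hbound : ∀ w, dist w c ≤ R' → ‖g w‖ ≤ 2 * M * R' / (R - R') := by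
    intro w hw
    have hmaps : ∀ v ∈ Metric.ball (0 : ℂ) R, v + c ∈ Metric.ball c R := by
      intro v hv
      simpa [dist_eq_norm] using hv
    have h1 := Complex.borelCaratheodory_zero (f := fun v => g (v + c)) (z := w - c) (R := R) hM
      (hgd.comp ((differentiable_id.add_const c).differentiableOn) hmaps)
      (fun v hv => hre _ (hmaps v hv)) (hr.trans_lt hrR)
      (by rw [mem_ball_zero_iff, ← dist_eq_norm]; linarith) (by simp [hgc])
    simp only [sub_add_cancel, ← dist_eq_norm] at h1
    refine h1.trans ?_
    have h2 : 0 < R - R' := by linarith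
    have h3 : 0 ≤ R' := by linarith
    gcongr
  have hsub : Metric.closedBall z ((R - r) / 2) ⊆ Metric.ball c R := by
    intro w hw
    have h1 : dist w z ≤ (R - r) / 2 := hw
    have := dist_triangle w z c
    exact lt_of_le_of_lt this (by linarith)
  have hcauchy := Complex.norm_deriv_le_of_forall_mem_sphere_norm_le (f := g) (c := z)
    (R := (R - r) / 2) (C := 2 * M * R' / (R - R')) (by linarith)
    (by
      refine DifferentiableOn.diffContOnCl ?_
      rw [closure_ball _ (by linarith : (R - r) / 2 ≠ 0)]
      exact hgd.mono hsub)
    (fun w hw => hbound w (by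
      have h1 : dist w z = (R - r) / 2 := hw
      have := dist_triangle w z c
      linarith))
  rw [(hg z hzR).deriv] at hcauchy
  refine hcauchy.trans (le_of_eq ?_)
  have : R - r ≠ 0 := by linarith
  rw [hR', show R - (R + r) / 2 = (R - r) / 2 by ring]
  field_simp
  ring

/-- On $\operatorname{Re}s=2$, $1/L(s,\chi)=\sum\mu(n)\chi(n)n^{-s}$ is at most $\zeta(2)$ in
modulus, uniformly in $q$. This supplies the lower bound at the centre of the discs. -/
theorem exists_one_le_mul_norm_LFunction : ∃ D : ℝ, 1 ≤ D ∧
    ∀ (q : ℕ) [NeZero q] (χ : DirichletCharacter ℂ q) (s : ℂ), s.re = 2 →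
      1 ≤ D * ‖χ.LFunction s‖ := by
  have hsum : Summable fun n : ℕ => 1 / (n : ℝ) ^ (2 : ℝ) :=
    Real.summable_one_div_nat_rpow.2 one_lt_two
  refine ⟨1 + ∑' n : ℕ, 1 / (n : ℝ) ^ (2 : ℝ),
    le_add_of_nonneg_right (tsum_nonneg fun n => by positivity), ?_⟩
  intro q _ χ s hs
  have hs1 : 1 < s.re := by linarith
  have h1 := DirichletCharacter.LSeries.mul_mu_eq_one χ hs1
  rw [DirichletCharacter.LFunction_eq_LSeries χ hs1]
  have h2 : ‖LSeries ((fun n : ℕ => χ n) * fun n => (ArithmeticFunction.moebius n : ℂ)) s‖ ≤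
      ∑' n : ℕ, 1 / (n : ℝ) ^ (2 : ℝ) := by
    refine tsum_of_norm_bounded hsum.hasSum fun n => ?_
    rw [LSeries.norm_term_eq, hs]
    split_ifs with h
    · positivity
    · gcongr
      rw [Pi.mul_apply, norm_mul]
      refine mul_le_one₀ (χ.norm_le_one _) (norm_nonneg _) ?_
      rw [Complex.norm_intCast]
      exact_mod_cast ArithmeticFunction.abs_moebius_le_one
  calc (1 : ℝ) = ‖LSeries ((fun n : ℕ => χ n) * fun n => (ArithmeticFunction.moebius n : ℂ)) s‖ *
        ‖LSeries (fun n => χ n) s‖ := by rw [← norm_mul, mul_comm, h1, norm_one]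
    _ ≤ _ := by gcongr; linarith

theorem GRH.LFunction_ne_zero (hGRH : GRH) {q : ℕ} [NeZero q] {χ : DirichletCharacter ℂ q}
    (hχ : χ ≠ 1) {z : ℂ} (hz : 1 / 2 < z.re) : χ.LFunction z ≠ 0 := by
  intro h
  rcases lt_or_ge z.re 1 with h1 | h1
  · have := hGRH q χ z h (by linarith) h1
    linarith
  · exact DirichletCharacter.LFunction_ne_zero_of_one_le_re χ (Or.inl hχ) h1 h

theorem GRH.exists_norm_logDeriv_LFunction_le (hGRH : GRH) {ε : ℝ} (hε : 0 < ε) (hε1 : ε ≤ 1) :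
    ∃ A : ℝ, 0 < A ∧ ∀ (q : ℕ) [NeZero q] (χ : DirichletCharacter ℂ q), χ ≠ 1 →
      ∀ z : ℂ, 1 / 2 + ε ≤ z.re → z.re ≤ 2 →
        ‖deriv χ.LFunction z / χ.LFunction z‖ ≤ A * (1 + Real.log q) * (1 + |z.im|) := by
  obtain ⟨D, hD1, hD⟩ := exists_one_le_mul_norm_LFunction
  have hlD : 0 ≤ Real.log (2 * D) := Real.log_nonneg (by linarith)
  -- The discs are centred at $2+it$: radius $R$ stays in $\operatorname{Re}w>1/2+\varepsilon/2$,
  -- which is zero-free, and radius $r$ reaches $\operatorname{Re}z=1/2+\varepsilon$.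
  set R := 3 / 2 - ε / 2 with hR
  set r := 3 / 2 - ε with hr
  have hRr : R - r = ε / 2 := by rw [hR, hr]; ring
  refine ⟨4 * (Real.log (2 * D) + 4) * (R + r) / (R - r) ^ 2,
    div_pos (mul_pos (by linarith) (by linarith)) (by rw [hRr]; positivity), ?_⟩
  intro q _ χ hχ z hz1 hz2
  set t := z.im with ht
  have hq1 : (1 : ℝ) ≤ q := by exact_mod_cast NeZero.one_le
  have hlq : 0 ≤ Real.log q := Real.log_nonneg hq1
  have ht0 := abs_nonneg t
  set c : ℂ := ⟨2, t⟩ with hc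
  set M := Real.log (2 * D * q * (|t| + 4)) with hM
  have hM' : M = Real.log (2 * D) + Real.log q + Real.log (|t| + 4) := by
    rw [hM, Real.log_mul (by positivity) (by positivity), Real.log_mul (by positivity) (by positivity)]
  have hMle : M ≤ (Real.log (2 * D) + 4) * (1 + Real.log q) * (1 + |t|) := by
    have := Real.log_le_sub_one_of_pos (by positivity : 0 < |t| + 4)
    have h1 := mul_nonneg hlD hlq
    have h2 := mul_nonneg hlD ht0
    have h3 := mul_nonneg hlq ht0
    have h4 := mul_nonneg hlD h3
    rw [hM']
    nlinarith
  have hMpos : 0 < M := by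
    have := Real.log_pos (by linarith : 1 < |t| + 4)
    rw [hM']; linarith
  have hre : ∀ w ∈ Metric.ball c R, 1 / 2 < w.re := by
    intro w hw
    have h1 : ‖w - c‖ < R := by rwa [Metric.mem_ball, dist_eq_norm] at hw
    have h2 := (Complex.abs_re_le_norm (w - c)).trans_lt h1
    have h3 := (abs_lt.1 h2).1
    simp only [Complex.sub_re, hc] at h3
    linarith
  have h := norm_deriv_div_le_of_norm_le_exp_mul (f := χ.LFunction) (c := c) (z := z) (R := R) (r := r)
    (M := M) (by linarith) (by linarith) hMpos
    (DirichletCharacter.differentiable_LFunction hχ).differentiableOn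
    (fun w hw => hGRH.LFunction_ne_zero hχ (hre w hw)) ?_ ?_
  · refine h.trans ?_
    have hd : 0 < R + r := by linarith
    calc 4 * M * (R + r) / (R - r) ^ 2
        ≤ 4 * ((Real.log (2 * D) + 4) * (1 + Real.log q) * (1 + |t|)) * (R + r) / (R - r) ^ 2 := by
          gcongr
      _ = _ := by ring
  · intro w hw
    have h1 := norm_LFunction_le hχ (by linarith [hre w hw] : 0 < w.re)
    have h2 : ‖w‖ ≤ |t| + 4 := by
      have e1 : ‖w - c‖ < R := by rwa [Metric.mem_ball, dist_eq_norm] at hw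
      have e2 : ‖c‖ ≤ 2 + |t| := (Complex.norm_le_abs_re_add_abs_im c).trans (by simp [hc])
      have e3 : ‖w‖ ≤ ‖w - c‖ + ‖c‖ := norm_le_norm_sub_add w c
      linarith
    have h3 := hD q χ c rfl
    rw [hM, Real.exp_log (by positivity)]
    have h4 : q * ‖w‖ / w.re ≤ 2 * (q * (|t| + 4)) := by
      rw [div_le_iff₀ (by linarith [hre w hw])]
      have e4 : q * ‖w‖ ≤ q * (|t| + 4) := by gcongr
      have e5 : 0 ≤ q * (|t| + 4) := by positivity
      nlinarith [hre w hw]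
    calc _ ≤ 2 * (q * (|t| + 4)) * 1 := by linarith
      _ ≤ 2 * (q * (|t| + 4)) * (D * ‖χ.LFunction c‖) := by gcongr
      _ = _ := by ring
  · have : z - c = ((z.re - 2 : ℝ) : ℂ) := by
      apply Complex.ext <;> simp [hc, ht]
    rw [dist_eq_norm, this, Complex.norm_real, Real.norm_eq_abs, abs_le]
    constructor <;> linarith

/-! ### The Gaussian kernel and the shift of contour -/

/-- The kernel `exp (z ^ 2 / 2) * X ^ z` with `L = log X`. -/
noncomputable def gaussKernel (L : ℝ) (z : ℂ) : ℂ := Complex.exp (z ^ 2 / 2 + z * L)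

theorem norm_gaussKernel (L x t : ℝ) :
    ‖gaussKernel L (x + t * Complex.I)‖ = Real.exp (x ^ 2 / 2 + x * L) * Real.exp (-(1 / 2) * t ^ 2) := by
  have h : (x + t * Complex.I : ℂ) ^ 2 / 2 + (x + t * Complex.I) * L =
      ((x ^ 2 / 2 + x * L - t ^ 2 / 2 : ℝ) : ℂ) + ((x * t + t * L : ℝ) : ℂ) * Complex.I := by
    push_cast
    linear_combination (t : ℂ) ^ 2 / 2 * Complex.I_sq
  rw [gaussKernel, Complex.norm_exp, h, ← Real.exp_add]
  congr 1
  simp only [Complex.add_re, Complex.ofReal_re, Complex.re_ofReal_mul, Complex.I_re, mul_zero]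
  ring

theorem differentiable_gaussKernel (L : ℝ) : Differentiable ℂ (gaussKernel L) := by
  unfold gaussKernel
  fun_prop

theorem integrable_one_add_abs_mul_exp :
    MeasureTheory.Integrable fun t : ℝ => (1 + |t|) * Real.exp (-(1 / 2) * t ^ 2) := by
  have h1 := integrable_exp_neg_mul_sq (b := 1 / 2) (by norm_num)
  have h2 := (integrable_mul_exp_neg_mul_sq (b := 1 / 2) (by norm_num)).norm
  refine (h1.add h2).congr (Eventually.of_forall fun t => ?_)
  simp only [Pi.add_apply, norm_mul, Real.norm_eq_abs, Real.abs_exp]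
  ring

theorem tendsto_one_add_mul_exp_neg_sq :
    Tendsto (fun T : ℝ => (1 + T) * Real.exp (-(1 / 2) * T ^ 2)) atTop (𝓝 0) := by
  have h0 := (Real.tendsto_pow_mul_exp_neg_atTop_nhds_zero 0)
  have h1 := (Real.tendsto_pow_mul_exp_neg_atTop_nhds_zero 1)
  have h2 := (h0.add h1).const_mul (Real.exp (1 / 2))
  simp only [pow_zero, one_mul, pow_one, add_zero, mul_zero] at h2
  refine squeeze_zero' ?_ ?_ h2
  · filter_upwards [eventually_ge_atTop 0] with T hT
    positivity
  · filter_upwards [eventually_ge_atTop 0] with T hT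
    rw [← one_add_mul, mul_left_comm, ← Real.exp_add]
    gcongr
    nlinarith [sq_nonneg (T - 1)]

section Strip

variable {F : ℂ → ℂ} {a b K : ℝ}

theorem integrable_mul_gaussKernel {x : ℝ} (L : ℝ)
    (hF : ∀ z : ℂ, z.re = x → DifferentiableAt ℂ F z)
    (hK : ∀ z : ℂ, z.re = x → ‖F z‖ ≤ K * (1 + |z.im|)) :
    MeasureTheory.Integrable
      fun t : ℝ => F (x + t * Complex.I) * gaussKernel L (x + t * Complex.I) := by
  have hline : Continuous fun t : ℝ => (x + t * Complex.I : ℂ) := by fun_prop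
  refine (integrable_one_add_abs_mul_exp.const_mul (K * Real.exp (x ^ 2 / 2 + x * L))).mono' ?_ ?_
  · refine Continuous.aestronglyMeasurable (Continuous.mul ?_ ?_)
    · exact continuous_iff_continuousAt.2 fun t =>
        ContinuousAt.comp (f := fun t : ℝ => (x + t * Complex.I : ℂ)) (g := F)
          (hF _ (by simp)).continuousAt hline.continuousAt
    · exact (differentiable_gaussKernel L).continuous.comp hline
  · refine Eventually.of_forall fun t => ?_
    rw [norm_mul, norm_gaussKernel]
    calc _ ≤ (K * (1 + |t|)) *
          (Real.exp (x ^ 2 / 2 + x * L) * Real.exp (-(1 / 2) * t ^ 2)) := by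
          gcongr
          simpa using hK (x + t * Complex.I) (by simp)
      _ = _ := by ring

theorem norm_integral_mul_gaussKernel_le {x : ℝ} (L : ℝ)
    (hK : ∀ z : ℂ, z.re = x → ‖F z‖ ≤ K * (1 + |z.im|)) :
    ‖∫ t : ℝ, F (x + t * Complex.I) * gaussKernel L (x + t * Complex.I)‖ ≤
      K * Real.exp (x ^ 2 / 2 + x * L) * ∫ t : ℝ, (1 + |t|) * Real.exp (-(1 / 2) * t ^ 2) := by
  rw [← MeasureTheory.integral_const_mul]
  refine MeasureTheory.norm_integral_le_of_norm_le
    (integrable_one_add_abs_mul_exp.const_mul _) (Eventually.of_forall fun t => ?_)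
  rw [norm_mul, norm_gaussKernel]
  calc _ ≤ (K * (1 + |t|)) *
        (Real.exp (x ^ 2 / 2 + x * L) * Real.exp (-(1 / 2) * t ^ 2)) := by
        gcongr
        simpa using hK (x + t * Complex.I) (by simp)
    _ = _ := by ring

/-- The function `y` stands for $T$ or $-T$, so that both horizontal edges are covered; Gaussian
decay beats the linear growth of $F$. -/
theorem tendsto_horizontal_integral_gaussKernel (hab : a ≤ b) (ha : 0 ≤ a) (hK0 : 0 ≤ K) (L : ℝ)
    (hK : ∀ z : ℂ, a ≤ z.re → z.re ≤ b → ‖F z‖ ≤ K * (1 + |z.im|)) (y : ℝ → ℝ)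
    (hy : ∀ T, 0 ≤ T → |y T| = T) :
    Tendsto (fun T : ℝ => ∫ x in a..b, F (x + (y T : ℂ) * Complex.I) *
      gaussKernel L (x + (y T : ℂ) * Complex.I)) atTop (𝓝 0) := by
  have hlim := tendsto_one_add_mul_exp_neg_sq.const_mul
    (K * Real.exp (b ^ 2 / 2 + b * |L|) * |b - a|)
  rw [mul_zero] at hlim
  refine squeeze_zero_norm' ?_ hlim
  filter_upwards [eventually_ge_atTop 0] with T hT
  calc _ ≤ (K * (1 + T)) * (Real.exp (b ^ 2 / 2 + b * |L|) * Real.exp (-(1 / 2) * T ^ 2)) * |b - a| := by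
        refine intervalIntegral.norm_integral_le_of_norm_le_const fun x hx => ?_
        rw [Set.uIoc_of_le hab] at hx
        have hy2 : (y T) ^ 2 = T ^ 2 := by rw [← sq_abs, hy T hT]
        rw [norm_mul, norm_gaussKernel, hy2]
        have hx0 : 0 ≤ x := ha.trans hx.1.le
        have h1 := hK (x + (y T : ℂ) * Complex.I) (by simpa using hx.1.le) (by simpa using hx.2)
        simp only [Complex.add_im, Complex.ofReal_im, Complex.mul_im, Complex.ofReal_re,
          Complex.I_im, Complex.I_re, mul_one, mul_zero, add_zero, zero_add, hy T hT] at h1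
        have h2 : x * L ≤ b * |L| :=
          (mul_le_mul_of_nonneg_left (le_abs_self L) hx0).trans
            (mul_le_mul_of_nonneg_right hx.2 (abs_nonneg L))
        have h3 : x ^ 2 ≤ b ^ 2 := pow_le_pow_left₀ hx0 hx.2 2
        gcongr
    _ = _ := by ring

/-- Shifting the line of integration of `F` against the Gaussian kernel. -/
theorem integral_mul_gaussKernel_eq (hab : a ≤ b) (ha : 0 ≤ a) (hK0 : 0 ≤ K) (L : ℝ)
    (hF : ∀ z : ℂ, a ≤ z.re → z.re ≤ b → DifferentiableAt ℂ F z)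
    (hK : ∀ z : ℂ, a ≤ z.re → z.re ≤ b → ‖F z‖ ≤ K * (1 + |z.im|)) :
    ∫ t : ℝ, F (b + t * Complex.I) * gaussKernel L (b + t * Complex.I) =
      ∫ t : ℝ, F (a + t * Complex.I) * gaussKernel L (a + t * Complex.I) := by
  set G : ℂ → ℂ := fun z => F z * gaussKernel L z with hG
  have hrect : ∀ T : ℝ,
      (∫ x in a..b, G (x + ((-T : ℝ) : ℂ) * Complex.I)) - (∫ x in a..b, G (x + (T : ℂ) * Complex.I)) +
        Complex.I • (∫ t in (-T)..T, G (b + t * Complex.I)) -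
        Complex.I • (∫ t in (-T)..T, G (a + t * Complex.I)) = 0 := by
    intro T
    have := Complex.integral_boundary_rect_eq_zero_of_differentiableOn G
      (a + ((-T : ℝ) : ℂ) * Complex.I) (b + (T : ℂ) * Complex.I) (by
        intro z hz
        have hz1 : z.re ∈ Set.uIcc a b := by simpa using hz.1
        rw [Set.uIcc_of_le hab] at hz1
        exact ((hF z hz1.1 hz1.2).mul (differentiable_gaussKernel L z)).differentiableWithinAt)
    simpa using this
  have htop : Tendsto (fun T : ℝ => T) atTop atTop := tendsto_id
  have hvert : ∀ x, a ≤ x → x ≤ b → Tendsto (fun T : ℝ => ∫ t in (-T)..T, G (x + t * Complex.I)) atTop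
      (𝓝 (∫ t : ℝ, G (x + t * Complex.I))) := fun x hx1 hx2 =>
    MeasureTheory.intervalIntegral_tendsto_integral
      (integrable_mul_gaussKernel L (fun z hz => hF z (hz ▸ hx1) (hz ▸ hx2))
        fun z hz => hK z (hz ▸ hx1) (hz ▸ hx2)) tendsto_neg_atTop_atBot htop
  have h1 := tendsto_horizontal_integral_gaussKernel hab ha hK0 L hK (fun T => -T)
    (fun T hT => by rw [abs_neg, abs_of_nonneg hT])
  have h2 := tendsto_horizontal_integral_gaussKernel hab ha hK0 L hK (fun T => T)
    (fun T hT => abs_of_nonneg hT)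
  have h3 := (((h1.sub h2).add ((hvert b hab le_rfl).const_smul Complex.I)).sub
    ((hvert a le_rfl hab).const_smul Complex.I))
  have h4 := tendsto_nhds_unique (h3.congr hrect) tendsto_const_nhds
  rw [sub_zero, zero_add, ← smul_sub, smul_eq_zero] at h4
  exact sub_eq_zero.1 (h4.resolve_left Complex.I_ne_zero)

end Strip

/-- On the line the exponent is quadratic in $t$; this is the Fourier transform of a Gaussian. -/
theorem integral_cpow_neg_mul_gaussKernel (L : ℝ) {n : ℕ} (hn : n ≠ 0) :
    ∫ t : ℝ, (n : ℂ) ^ (-(2 + t * Complex.I)) * gaussKernel L (2 + t * Complex.I) =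
      (2 * Real.pi : ℂ) ^ (1 / 2 : ℂ) * Complex.exp (-(L - Real.log n) ^ 2 / 2) := by
  set m : ℂ := L - Real.log n with hm
  have h := integral_cexp_quadratic (b := -(1 / 2)) (by norm_num) (Complex.I * (2 + m)) (2 + 2 * m)
  convert h using 1
  · refine MeasureTheory.integral_congr_ae (Eventually.of_forall fun t => ?_)
    simp only
    rw [Complex.cpow_def_of_ne_zero (by exact_mod_cast hn), gaussKernel, ← Complex.exp_add,
      ← Complex.natCast_log, hm]
    congr 1
    linear_combination (t : ℂ) ^ 2 / 2 * Complex.I_sq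
  · congr 1
    · congr 1; ring
    · congr 1
      linear_combination (-(2 + m) ^ 2 / 2) * Complex.I_sq

theorem hasSum_mul_exp_neg_log_sq {c : ℕ → ℂ} (hc0 : c 0 = 0) (hc : LSeriesSummable c 2) (L : ℝ) :
    HasSum (fun n : ℕ => (2 * Real.pi : ℂ) ^ (1 / 2 : ℂ) *
        (c n * Complex.exp (-(L - Real.log n) ^ 2 / 2)))
      (∫ t : ℝ, LSeries c (2 + t * Complex.I) * gaussKernel L (2 + t * Complex.I)) := by
  set Φ : ℕ → ℝ → ℂ := fun n t =>
    LSeries.term c (2 + t * Complex.I) n * gaussKernel L (2 + t * Complex.I) with hΦ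
  have hΦ' : ∀ n t, Φ n t = c n * ((n : ℂ) ^ (-(2 + t * Complex.I)) *
      gaussKernel L (2 + t * Complex.I)) := by
    intro n t
    simp only [hΦ]
    rw [LSeries.term_def₀ hc0]
    ring
  have hnorm : ∀ n t, ‖Φ n t‖ = ‖LSeries.term c 2 n‖ *
      (Real.exp (2 ^ 2 / 2 + 2 * L) * Real.exp (-(1 / 2) * t ^ 2)) := by
    intro n t
    have := norm_gaussKernel L 2 t
    push_cast at this
    simp only [hΦ]
    rw [norm_mul, this, LSeries.norm_term_eq, LSeries.norm_term_eq]
    simp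
  have hexp := integrable_exp_neg_mul_sq (b := 1 / 2) (by norm_num)
  have hmeas : ∀ n, Continuous (Φ n) := by
    intro n
    rcases eq_or_ne n 0 with rfl | hn
    · simp only [hΦ, LSeries.term_zero, zero_mul]
      exact continuous_const
    · have : Φ n = fun t : ℝ => c n * ((n : ℂ) ^ (-(2 + t * Complex.I)) *
          gaussKernel L (2 + t * Complex.I)) := funext (hΦ' n)
      rw [this]
      refine continuous_const.mul (Continuous.mul ?_ ?_)
      · exact Continuous.const_cpow (by fun_prop) (Or.inl (by exact_mod_cast hn))
      · exact (differentiable_gaussKernel L).continuous.comp (by fun_prop)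
  have h := MeasureTheory.hasSum_integral_of_summable_integral_norm (F := Φ)
    (μ := MeasureTheory.volume) (fun n => by
      refine ((hexp.const_mul (Real.exp (2 ^ 2 / 2 + 2 * L))).const_mul ‖LSeries.term c 2 n‖).mono'
        (hmeas n).aestronglyMeasurable (Eventually.of_forall fun t => (hnorm n t).le))
    (by
      simp only [hnorm, MeasureTheory.integral_const_mul]
      exact hc.norm.mul_right _)
  have h1 : (fun n : ℕ => (2 * Real.pi : ℂ) ^ (1 / 2 : ℂ) *
      (c n * Complex.exp (-(L - Real.log n) ^ 2 / 2))) = fun n => ∫ t, Φ n t := by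
    funext n
    rcases eq_or_ne n 0 with rfl | hn
    · simp [hΦ, hc0]
    · simp only [hΦ']
      rw [MeasureTheory.integral_const_mul, integral_cpow_neg_mul_gaussKernel L hn]
      ring
  have h2 : (∫ t : ℝ, LSeries c (2 + t * Complex.I) * gaussKernel L (2 + t * Complex.I)) =
      ∫ t, ∑' n, Φ n t := by
    refine MeasureTheory.integral_congr_ae (Eventually.of_forall fun t => ?_)
    simp only [hΦ]
    rw [tsum_mul_right]
    rfl
  rw [h1, h2]
  exact h

/-! ### Smoothed sums over primes -/

/-- The weight `exp (-(log (X / n)) ^ 2 / 2)`. -/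
noncomputable def logGaussWeight (X : ℝ) (n : ℕ) : ℝ := Real.exp (-(Real.log X - Real.log n) ^ 2 / 2)

theorem ofReal_logGaussWeight (X : ℝ) (n : ℕ) :
    (logGaussWeight X n : ℂ) = Complex.exp (-(Real.log X - Real.log n) ^ 2 / 2) := by
  rw [logGaussWeight]
  push_cast
  rfl

theorem logGaussWeight_nonneg (X : ℝ) (n : ℕ) : 0 ≤ logGaussWeight X n := (Real.exp_pos _).le

theorem logGaussWeight_le_one (X : ℝ) (n : ℕ) : logGaussWeight X n ≤ 1 :=
  Real.exp_le_one_iff.2 (by nlinarith [sq_nonneg (Real.log X - Real.log n)])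

theorem logGaussWeight_le_div_sq {X : ℝ} (hX : 0 < X) {n : ℕ} (hn : n ≠ 0) :
    logGaussWeight X n ≤ Real.exp 2 * X ^ 2 / (n : ℝ) ^ 2 := by
  have hn' : (0 : ℝ) < n := by exact_mod_cast Nat.pos_of_ne_zero hn
  calc logGaussWeight X n ≤ Real.exp (2 + 2 * (Real.log X - Real.log n)) :=
        -- With $y=\log(X/n)$, $(y+2)^2\ge0$ says $-y^2/2\le2+2y$.
        Real.exp_le_exp.2 (by nlinarith [sq_nonneg (Real.log X - Real.log n + 2)])
    _ = _ := by
      rw [Real.exp_add, mul_sub, Real.exp_sub, mul_comm 2 (Real.log X), mul_comm 2 (Real.log n),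
        Real.exp_mul, Real.exp_mul, Real.exp_log hX, Real.exp_log hn']
      norm_cast
      rw [mul_div_assoc]

theorem exp_neg_le_logGaussWeight {X : ℝ} (hX : 0 < X) {n : ℕ} (h1 : X ≤ n) (h2 : n ≤ 2 * X) :
    Real.exp (-1 / 2) ≤ logGaussWeight X n := by
  have h3 : Real.log X ≤ Real.log n := Real.log_le_log hX h1
  have h4 : Real.log n ≤ Real.log 2 + Real.log X := by
    rw [← Real.log_mul two_ne_zero hX.ne']
    exact Real.log_le_log (hX.trans_le h1) h2
  have h5 := Real.log_two_lt_d9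
  refine Real.exp_le_exp.2 ?_
  have : (Real.log X - Real.log n) ^ 2 ≤ 1 := by
    rw [sq_le_one_iff_abs_le_one, abs_le]
    constructor <;> linarith
  linarith

theorem summable_vonMangoldt_mul_logGaussWeight {X : ℝ} (hX : 0 < X) :
    Summable fun n => ArithmeticFunction.vonMangoldt n * logGaussWeight X n := by
  have h := (ArithmeticFunction.LSeriesSummable_vonMangoldt (s := 2) (by simp)).norm
  refine Summable.of_nonneg_of_le
    (fun n => mul_nonneg ArithmeticFunction.vonMangoldt_nonneg (logGaussWeight_nonneg X n))
    (fun n => ?_) (h.mul_left (Real.exp 2 * X ^ 2))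
  rw [LSeries.norm_term_eq]
  rcases eq_or_ne n 0 with rfl | hn
  · simp
  · rw [if_neg hn, Complex.norm_real, Real.norm_eq_abs,
      abs_of_nonneg ArithmeticFunction.vonMangoldt_nonneg]
    refine (mul_le_mul_of_nonneg_left (logGaussWeight_le_div_sq hX hn)
      ArithmeticFunction.vonMangoldt_nonneg).trans (le_of_eq ?_)
    simp only [Complex.re_ofNat, Real.rpow_ofNat]
    ring

/-- The sum is, up to $\sqrt{2\pi}$, the integral of $-L'/L$ against the kernel on
$\operatorname{Re}z=2$. As $\chi\ne1$, $L$ is entire, and GRH excludes zeros to the right of $1/2$,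
so the line moves to $1/2+\varepsilon$ without residues. -/
theorem GRH.exists_norm_tsum_vonMangoldt_le (hGRH : GRH) {ε : ℝ} (hε : 0 < ε) (hε1 : ε ≤ 1) :
    ∃ A : ℝ, 0 < A ∧ ∀ (q : ℕ) [NeZero q] (χ : DirichletCharacter ℂ q), χ ≠ 1 → ∀ X : ℝ, 0 < X →
      ‖∑' n : ℕ, χ n * (ArithmeticFunction.vonMangoldt n * logGaussWeight X n : ℝ)‖ ≤
        A * (1 + Real.log q) * X ^ (1 / 2 + ε) := by
  obtain ⟨A, hA, hbound⟩ := hGRH.exists_norm_logDeriv_LFunction_le hε hε1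
  set J := ∫ t : ℝ, (1 + |t|) * Real.exp (-(1 / 2) * t ^ 2) with hJ
  have hJ0 : 0 ≤ J := MeasureTheory.integral_nonneg fun t => by positivity
  set a := 1 / 2 + ε with ha
  refine ⟨A * Real.exp (a ^ 2 / 2) * (1 + J), by positivity, ?_⟩
  intro q _ χ hχ X hX
  have hq1 : (1 : ℝ) ≤ q := by exact_mod_cast NeZero.one_le
  have hlq : 0 ≤ Real.log q := Real.log_nonneg hq1
  set L := Real.log X with hL
  set c : ℕ → ℂ := (fun n : ℕ => χ n) * fun n => (ArithmeticFunction.vonMangoldt n : ℂ) with hc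
  set F : ℂ → ℂ := fun z => -deriv χ.LFunction z / χ.LFunction z with hF
  have hLd := DirichletCharacter.differentiable_LFunction hχ
  have hFd : ∀ z : ℂ, a ≤ z.re → z.re ≤ 2 → DifferentiableAt ℂ F z := by
    intro z hz _
    have hd : Differentiable ℂ (deriv χ.LFunction) :=
      differentiableOn_univ.1 (hLd.differentiableOn.deriv isOpen_univ)
    exact (hd z).neg.div (hLd z) (hGRH.LFunction_ne_zero hχ (by linarith))
  have hFb : ∀ z : ℂ, a ≤ z.re → z.re ≤ 2 → ‖F z‖ ≤ A * (1 + Real.log q) * (1 + |z.im|) := by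
    intro z hz1 hz2
    simp only [hF]
    rw [neg_div, norm_neg]
    exact hbound q χ hχ z hz1 hz2
  have hsum := hasSum_mul_exp_neg_log_sq (c := c) (by simp [hc])
    (DirichletCharacter.LSeriesSummable_twist_vonMangoldt χ (by simp)) L
  have hcongr : (∫ t : ℝ, LSeries c (2 + t * Complex.I) * gaussKernel L (2 + t * Complex.I)) =
      ∫ t : ℝ, F ((2 : ℝ) + t * Complex.I) * gaussKernel L ((2 : ℝ) + t * Complex.I) := by
    refine MeasureTheory.integral_congr_ae (Eventually.of_forall fun t => ?_)
    have hre : 1 < (2 + t * Complex.I).re := by simp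
    simp only [hF, hc]
    rw [DirichletCharacter.LSeries_twist_vonMangoldt_eq χ hre,
      ← DirichletCharacter.deriv_LFunction_eq_deriv_LSeries χ hre,
      ← DirichletCharacter.LFunction_eq_LSeries χ hre]
    push_cast
    rfl
  have hshift := integral_mul_gaussKernel_eq (F := F) (a := a) (b := 2) (by linarith) (by linarith)
    (by positivity) L hFd hFb
  have hest := norm_integral_mul_gaussKernel_le (F := F) (x := a) L
    (K := A * (1 + Real.log q)) (fun z hz => hFb z hz.ge (by linarith))
  rw [← hshift, ← hcongr, ← hsum.tsum_eq, tsum_mul_left, norm_mul] at hest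
  have hpi : (1 : ℝ) ≤ ‖(2 * Real.pi : ℂ) ^ (1 / 2 : ℂ)‖ := by
    have : (2 * Real.pi : ℂ) = ((2 * Real.pi : ℝ) : ℂ) := by push_cast; rfl
    rw [this, Complex.norm_cpow_eq_rpow_re_of_pos (by positivity)]
    exact Real.one_le_rpow (by linarith [Real.pi_gt_three]) (by norm_num)
  have heq : ∑' n : ℕ, χ n * (ArithmeticFunction.vonMangoldt n * logGaussWeight X n : ℝ) =
      ∑' n : ℕ, c n * Complex.exp (-(L - Real.log n) ^ 2 / 2) := by
    refine tsum_congr fun n => ?_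
    rw [hc, Pi.mul_apply, Complex.ofReal_mul, ofReal_logGaussWeight, mul_assoc]
  rw [heq]
  calc _ ≤ ‖(2 * Real.pi : ℂ) ^ (1 / 2 : ℂ)‖ *
        ‖∑' n : ℕ, c n * Complex.exp (-(L - Real.log n) ^ 2 / 2)‖ :=
        le_mul_of_one_le_left (norm_nonneg _) hpi
    _ ≤ A * (1 + Real.log q) * Real.exp (a ^ 2 / 2 + a * L) * J := hest
    _ = A * Real.exp (a ^ 2 / 2) * J * (1 + Real.log q) * X ^ a := by
        rw [Real.exp_add, mul_comm a L, Real.exp_mul, Real.exp_log hX]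
        ring
    _ ≤ A * Real.exp (a ^ 2 / 2) * (1 + J) * (1 + Real.log q) * X ^ a := by
        gcongr
        linarith

/-- Partial summation with $\psi(t)\ll t$: the partial sums vanish up to $X$, leaving
$2\int_X^\infty t^{-2}\,dt$ up to a constant. -/
theorem LSeries_indicator_vonMangoldt_le {X : ℝ} (hX : 1 ≤ X) :
    ‖LSeries (fun n : ℕ => ((if X < n then ArithmeticFunction.vonMangoldt n else 0 : ℝ) : ℂ)) 2‖ ≤
      2 * (Real.log 4 + 4) / X := by
  set b : ℕ → ℝ := fun n => if X < n then ArithmeticFunction.vonMangoldt n else 0 with hb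
  have hX0 : 0 < X := by linarith
  have hC : 0 ≤ Real.log 4 + 4 := by have := Real.log_nonneg (by norm_num : (1 : ℝ) ≤ 4); linarith
  have hb0 : ∀ n, 0 ≤ b n := fun n => by
    simp only [hb]; split_ifs; exacts [ArithmeticFunction.vonMangoldt_nonneg, le_rfl]
  have hble : ∀ n, b n ≤ ArithmeticFunction.vonMangoldt n := fun n => by
    simp only [hb]; split_ifs; exacts [le_rfl, ArithmeticFunction.vonMangoldt_nonneg]
  have hsum : ∀ t : ℝ, 0 ≤ t → ∑ k ∈ Finset.Icc 1 ⌊t⌋₊, b k ≤ (Real.log 4 + 4) * t := by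
    intro t ht
    refine le_trans ?_ (Chebyshev.psi_le_const_mul_self ht)
    exact Finset.sum_le_sum fun k _ => hble k
  have hint := LSeries_eq_mul_integral_of_nonneg b zero_le_one (s := 2) (by simp)
    (by
      refine Asymptotics.IsBigO.of_bound (Real.log 4 + 4) (Eventually.of_forall fun n => ?_)
      have := hsum n (Nat.cast_nonneg n)
      rw [Nat.floor_natCast] at this
      rw [Real.norm_of_nonneg (Finset.sum_nonneg fun k _ => hb0 k), Real.rpow_one,
        Real.norm_of_nonneg (Nat.cast_nonneg n)]
      exact this) hb0
  rw [hint, norm_mul]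
  have hg : MeasureTheory.IntegrableOn (fun t : ℝ => (Real.log 4 + 4) * t ^ (-2 : ℝ)) (Set.Ioi X) :=
    (integrableOn_Ioi_rpow_of_lt (by norm_num) hX0).const_mul _
  have hle := MeasureTheory.norm_integral_le_of_norm_le
    (μ := MeasureTheory.volume.restrict (Set.Ioi 1))
    (f := fun t : ℝ => (∑ k ∈ Finset.Icc 1 ⌊t⌋₊, (b k : ℂ)) * (t : ℂ) ^ (-((2 : ℂ) + 1)))
    (g := (Set.Ioi X).indicator fun t : ℝ => (Real.log 4 + 4) * t ^ (-2 : ℝ))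
    ((MeasureTheory.integrable_indicator_iff measurableSet_Ioi).2
      (MeasureTheory.IntegrableOn.mono_measure hg MeasureTheory.Measure.restrict_le_self))
    (by
      refine (MeasureTheory.ae_restrict_iff' measurableSet_Ioi).2 (Eventually.of_forall fun t ht => ?_)
      have ht0 : 0 < t := one_pos.trans ht
      by_cases htX : X < t
      · rw [Set.indicator_of_mem (by exact htX), norm_mul, Complex.norm_cpow_eq_rpow_re_of_pos ht0,
          ← Complex.ofReal_sum, Complex.norm_real,
          Real.norm_of_nonneg (Finset.sum_nonneg fun k _ => hb0 k)]
        calc _ ≤ (Real.log 4 + 4) * t * t ^ (-(2 + 1) : ℂ).re := by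
              gcongr
              exact hsum t ht0.le
          _ = _ := by
              rw [mul_assoc]
              congr 1
              nth_rewrite 1 [← Real.rpow_one t]
              rw [← Real.rpow_add ht0]
              congr 1
              norm_num
      · rw [Set.indicator_of_notMem (by exact htX), Finset.sum_eq_zero, zero_mul, norm_zero]
        intro k hk
        have hk' : (k : ℝ) ≤ t := (Nat.le_floor_iff ht0.le).1 (Finset.mem_Icc.1 hk).2
        simp only [hb]
        rw [if_neg (by linarith), Complex.ofReal_zero])
  rw [MeasureTheory.setIntegral_indicator measurableSet_Ioi,
    Set.inter_eq_right.2 (Set.Ioi_subset_Ioi hX), MeasureTheory.integral_const_mul,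
    integral_Ioi_rpow_of_lt (by norm_num) hX0] at hle
  calc _ ≤ ‖(2 : ℂ)‖ * ((Real.log 4 + 4) * (-X ^ ((-2 : ℝ) + 1) / (-2 + 1))) := by gcongr
    _ = _ := by
      rw [show (-2 : ℝ) + 1 = -1 by norm_num, Real.rpow_neg_one, Complex.norm_ofNat]
      field_simp

/-- Up to $X$ the weight is at most $1$ and Chebyshev applies; beyond $X$ it is at most
$e^2(X/n)^2$, and the tail of $\sum\Lambda(n)/n^2$ is $O(1/X)$. -/
theorem exists_tsum_vonMangoldt_mul_logGaussWeight_le :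
    ∃ A : ℝ, 0 < A ∧ ∀ X : ℝ, 1 ≤ X →
      ∑' n, ArithmeticFunction.vonMangoldt n * logGaussWeight X n ≤ A * X := by
  have hC : 0 ≤ Real.log 4 + 4 := by have := Real.log_nonneg (by norm_num : (1 : ℝ) ≤ 4); linarith
  refine ⟨1 + (Real.log 4 + 4) + Real.exp 2 * (2 * (Real.log 4 + 4)), by positivity, fun X hX => ?_⟩
  have hX0 : 0 < X := by linarith
  set b : ℕ → ℝ := fun n => if X < n then ArithmeticFunction.vonMangoldt n else 0 with hb
  have hb0 : ∀ n, 0 ≤ b n := fun n => by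
    simp only [hb]; split_ifs; exacts [ArithmeticFunction.vonMangoldt_nonneg, le_rfl]
  have hble : ∀ n, b n ≤ ArithmeticFunction.vonMangoldt n := fun n => by
    simp only [hb]; split_ifs; exacts [le_rfl, ArithmeticFunction.vonMangoldt_nonneg]
  have hbsum : Summable fun n : ℕ => b n / (n : ℝ) ^ 2 := by
    refine Summable.of_nonneg_of_le (fun n => by have := hb0 n; positivity) (fun n => ?_)
      (ArithmeticFunction.LSeriesSummable_vonMangoldt (s := 2) (by simp)).norm
    rw [LSeries.norm_term_eq]
    rcases eq_or_ne n 0 with rfl | hn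
    · simp
    · rw [if_neg hn, Complex.norm_real, Real.norm_eq_abs,
        abs_of_nonneg ArithmeticFunction.vonMangoldt_nonneg]
      simp only [Complex.re_ofNat, Real.rpow_ofNat]
      gcongr
      exact hble n
  have htail : ∑' n : ℕ, b n / (n : ℝ) ^ 2 ≤ 2 * (Real.log 4 + 4) / X := by
    refine le_trans (le_of_eq ?_) (LSeries_indicator_vonMangoldt_le hX)
    have : LSeries (fun n : ℕ => ((b n : ℝ) : ℂ)) 2 = ((∑' n : ℕ, b n / (n : ℝ) ^ 2 : ℝ) : ℂ) := by
      rw [LSeries, Complex.ofReal_tsum]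
      refine tsum_congr fun n => ?_
      rcases eq_or_ne n 0 with rfl | hn
      · simp
      · rw [LSeries.term_of_ne_zero hn]
        push_cast
        norm_cast
    rw [this, Complex.norm_real,
      Real.norm_of_nonneg (tsum_nonneg fun n => by have := hb0 n; positivity)]
  set S := Finset.Icc 1 ⌊X⌋₊ with hS
  have hpt : ∀ n : ℕ, ArithmeticFunction.vonMangoldt n * logGaussWeight X n ≤
      (if n ∈ S then ArithmeticFunction.vonMangoldt n else 0) +
        Real.exp 2 * X ^ 2 * (b n / (n : ℝ) ^ 2) := by
    intro n
    have h0 : 0 ≤ ArithmeticFunction.vonMangoldt n := ArithmeticFunction.vonMangoldt_nonneg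
    rcases eq_or_ne n 0 with rfl | hn
    · simp [hS]
    by_cases hnX : X < n
    · have hnS : n ∉ S := fun h => by
        have := (Nat.le_floor_iff hX0.le).1 (Finset.mem_Icc.1 h).2
        linarith
      rw [if_neg hnS, zero_add]
      simp only [hb, if_pos hnX]
      refine (mul_le_mul_of_nonneg_left (logGaussWeight_le_div_sq hX0 hn) h0).trans (le_of_eq ?_)
      ring
    · have hnS : n ∈ S := Finset.mem_Icc.2
        ⟨Nat.pos_of_ne_zero hn, (Nat.le_floor_iff hX0.le).2 (not_lt.1 hnX)⟩
      rw [if_pos hnS]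
      simp only [hb, if_neg hnX, zero_div, mul_zero, add_zero]
      exact mul_le_of_le_one_right h0 (logGaussWeight_le_one X n)
  have hfin : HasSum (fun n : ℕ => if n ∈ S then ArithmeticFunction.vonMangoldt n else 0)
      (∑ n ∈ S, ArithmeticFunction.vonMangoldt n) := by
    have : HasSum (fun n : ℕ => if n ∈ S then ArithmeticFunction.vonMangoldt n else 0)
        (∑ n ∈ S, if n ∈ S then ArithmeticFunction.vonMangoldt n else 0) :=
      hasSum_sum_of_ne_finset_zero fun n hn => if_neg hn
    rwa [Finset.sum_congr rfl fun n hn => if_pos hn] at this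
  have hpsi : ∑ n ∈ S, ArithmeticFunction.vonMangoldt n ≤ (Real.log 4 + 4) * X :=
    Chebyshev.psi_le_const_mul_self hX0.le
  calc _ ≤ ∑' n : ℕ, ((if n ∈ S then ArithmeticFunction.vonMangoldt n else 0) +
        Real.exp 2 * X ^ 2 * (b n / (n : ℝ) ^ 2)) :=
        (summable_vonMangoldt_mul_logGaussWeight hX0).tsum_le_tsum hpt
          (hfin.summable.add (hbsum.mul_left _))
    _ = ∑ n ∈ S, ArithmeticFunction.vonMangoldt n +
        Real.exp 2 * X ^ 2 * ∑' n : ℕ, b n / (n : ℝ) ^ 2 := by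
        rw [hfin.summable.tsum_add (hbsum.mul_left _), hfin.tsum_eq, tsum_mul_left]
    _ ≤ (Real.log 4 + 4) * X + Real.exp 2 * X ^ 2 * (2 * (Real.log 4 + 4) / X) := by gcongr
    _ = ((Real.log 4 + 4) + Real.exp 2 * (2 * (Real.log 4 + 4))) * X := by
        field_simp
    _ ≤ _ := mul_le_mul_of_nonneg_right (by linarith) hX0.le

theorem exists_le_primeCounting_mul_log :
    ∃ B : ℝ, 0 < B ∧ ∀ X : ℝ, 2 ≤ X → X ≤ B * ((Nat.primeCounting ⌊X⌋₊ : ℝ) * Real.log X) := by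
  have hl2 := Real.log_two_gt_d9
  -- The constant is set by $X\le8$, where $\pi(X)\ge1$ and $12\cdot0.69>8$; larger $X$ leave room
  -- to spare.
  refine ⟨12, by norm_num, fun X hX => ?_⟩
  have hlog : 0.69 ≤ Real.log X := by
    have := Real.log_le_log two_pos hX
    linarith
  rcases le_or_gt X 8 with h | h
  · have hpi : (1 : ℝ) ≤ Nat.primeCounting ⌊X⌋₊ := by
      have h2 : 2 ≤ ⌊X⌋₊ := Nat.le_floor (by exact_mod_cast hX)
      have := Nat.monotone_primeCounting h2
      have h3 : Nat.primeCounting 2 = 1 := by decide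
      exact_mod_cast h3 ▸ this
    nlinarith
  · have h1 := Chebyshev.psi_ge' (by linarith : 0 ≤ X)
    have h2 := Chebyshev.psi_le_primeCounting_mul_log' X
    have h3 : Real.log (X + 2) ≤ X / 4 + 1 := by
      have e1 : Real.log (X + 2) = Real.log ((X + 2) / 8) + Real.log 8 := by
        rw [← Real.log_mul (by positivity) (by norm_num)]
        congr 1
        ring
      have e2 := Real.log_le_sub_one_of_pos (by positivity : 0 < (X + 2) / 8)
      have e3 : Real.log 8 = 3 * Real.log 2 := by
        rw [show (8 : ℝ) = 2 ^ 3 by norm_num, Real.log_pow]; norm_num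
      have := Real.log_two_lt_d9
      linarith
    nlinarith

/-! ### Expanding the moment over tuples -/

/-- The weighted von Mangoldt function `Λ(n) exp (-(log (X / n)) ^ 2 / 2)`, restricted to odd `n`. -/
noncomputable def oddWeight (X : ℝ) (n : ℕ) : ℝ :=
  if Odd n then ArithmeticFunction.vonMangoldt n * logGaussWeight X n else 0

theorem oddWeight_nonneg (X : ℝ) (n : ℕ) : 0 ≤ oddWeight X n := by
  unfold oddWeight
  split_ifs
  exacts [mul_nonneg ArithmeticFunction.vonMangoldt_nonneg (logGaussWeight_nonneg X n), le_rfl]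

theorem oddWeight_le (X : ℝ) (n : ℕ) :
    oddWeight X n ≤ ArithmeticFunction.vonMangoldt n * logGaussWeight X n := by
  unfold oddWeight
  split_ifs
  exacts [le_rfl, mul_nonneg ArithmeticFunction.vonMangoldt_nonneg (logGaussWeight_nonneg X n)]

theorem norm_jacobiSym_le_one (a : ℤ) (n : ℕ) : ‖(jacobiSym a n : ℂ)‖ ≤ 1 := by
  rcases jacobiSym.trichotomy a n with h | h | h <;> simp [h]

theorem norm_oddWeight_mul_jacobiSym_le (X : ℝ) (a : ℤ) (n : ℕ) :
    ‖(oddWeight X n : ℂ) * jacobiSym a n‖ ≤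
      ArithmeticFunction.vonMangoldt n * logGaussWeight X n := by
  rw [norm_mul, Complex.norm_real, Real.norm_of_nonneg (oddWeight_nonneg X n)]
  exact (mul_le_of_le_one_right (oddWeight_nonneg X n) (norm_jacobiSym_le_one a n)).trans
    (oddWeight_le X n)

theorem summable_oddWeight_mul_jacobiSym {X : ℝ} (hX : 0 < X) (a : ℤ) :
    Summable fun n => (oddWeight X n : ℂ) * jacobiSym a n :=
  (summable_vonMangoldt_mul_logGaussWeight hX).of_norm_bounded
    fun n => norm_oddWeight_mul_jacobiSym_le X a n

theorem norm_tsum_oddWeight_mul_jacobiSym_le {X : ℝ} (hX : 0 < X) (a : ℤ) :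
    ‖∑' n, (oddWeight X n : ℂ) * jacobiSym a n‖ ≤
      ∑' n, ArithmeticFunction.vonMangoldt n * logGaussWeight X n :=
  tsum_of_norm_bounded (summable_vonMangoldt_mul_logGaussWeight hX).hasSum
    fun n => norm_oddWeight_mul_jacobiSym_le X a n

theorem GRH.exists_norm_tsum_oddWeight_mul_jacobiSym_le (hGRH : GRH) {ε : ℝ} (hε : 0 < ε)
    (hε1 : ε ≤ 1) : ∃ A : ℝ, 0 < A ∧ ∀ N : ℕ, N ≠ 0 → ¬ IsSquare N → ∀ X : ℝ, 0 < X →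
      ‖∑' n, (oddWeight X n : ℂ) * jacobiSym N n‖ ≤
        A * (1 + Real.log (4 * N)) * X ^ (1 / 2 + ε) := by
  obtain ⟨A, hA, h⟩ := hGRH.exists_norm_tsum_vonMangoldt_le hε hε1
  refine ⟨A, hA, fun N hN hsq X hX => ?_⟩
  have : NeZero N := ⟨hN⟩
  have h1 := h (4 * N) (jacobiChar N) (jacobiChar_ne_one hsq) X hX
  push_cast at h1
  refine le_trans (le_of_eq ?_) h1
  congr 1
  refine tsum_congr fun n => ?_
  unfold oddWeight
  split_ifs with hn
  · rw [jacobiChar_apply_of_odd N hn]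
    push_cast
    ring
  · rw [jacobiChar_apply_of_not_odd N hn]
    simp

/-- The weighted sum of Jacobi symbols `∑_{u < m ≤ u + h} α_m (m / n)`. -/
noncomputable def weightedJacobiSum (n : ℕ) (α : ℕ → ℂ) (u h : ℕ) : ℂ :=
  ∑ m ∈ Finset.Ioc u (u + h), α m * (jacobiSym m n : ℂ)

/-- The coefficient of a tuple in the expansion of the `2s`-th power of a weighted sum. -/
noncomputable def tupleCoeff (s : ℕ) (α : ℕ → ℂ) (t : Fin (2 * s) → ℕ) : ℂ :=
  ∏ i : Fin (2 * s), if (i : ℕ) < s then α (t i) else (starRingEnd ℂ) (α (t i))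

theorem norm_tupleCoeff_le_one {s : ℕ} {α : ℕ → ℂ} {t : Fin (2 * s) → ℕ}
    (h : ∀ i, ‖α (t i)‖ ≤ 1) : ‖tupleCoeff s α t‖ ≤ 1 := by
  rw [tupleCoeff, norm_prod]
  refine Finset.prod_le_one (fun _ _ => norm_nonneg _) fun i _ => ?_
  split_ifs
  · exact h i
  · rw [RCLike.norm_conj]; exact h i

theorem jacobiSym_prod {ι : Type*} (S : Finset ι) (f : ι → ℕ) (n : ℕ) :
    jacobiSym ((∏ i ∈ S, f i : ℕ) : ℤ) n = ∏ i ∈ S, jacobiSym (f i) n := by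
  classical
  induction S using Finset.induction_on with
  | empty => simp
  | insert a S ha ih => rw [Finset.prod_insert ha, Finset.prod_insert ha, Nat.cast_mul, jacobiSym.mul_left, ih]

/-- $|S|^{2s}=S^s\overline{S}^s$, and conjugation touches only the weights because the symbols are
real. -/
theorem norm_weightedJacobiSum_pow (s n : ℕ) (α : ℕ → ℂ) (u h : ℕ) :
    ((‖weightedJacobiSum n α u h‖ ^ (2 * s) : ℝ) : ℂ) =
      ∑ t ∈ Fintype.piFinset fun _ : Fin (2 * s) => Finset.Ioc u (u + h),
        tupleCoeff s α t * (jacobiSym ((∏ i, t i : ℕ) : ℤ) n : ℂ) := by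
  have hconj : (starRingEnd ℂ) (weightedJacobiSum n α u h) = ∑ m ∈ Finset.Ioc u (u + h),
      (starRingEnd ℂ) (α m) * (jacobiSym m n : ℂ) := by
    simp [weightedJacobiSum, map_sum]
  have h1 : ((‖weightedJacobiSum n α u h‖ ^ (2 * s) : ℝ) : ℂ) = ∏ i : Fin (2 * s),
      ∑ m ∈ Finset.Ioc u (u + h),
        (if (i : ℕ) < s then α m else (starRingEnd ℂ) (α m)) * (jacobiSym m n : ℂ) := by
    have h2 : ∀ i : Fin (2 * s), (∑ m ∈ Finset.Ioc u (u + h),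
        (if (i : ℕ) < s then α m else (starRingEnd ℂ) (α m)) * (jacobiSym m n : ℂ)) =
        if (i : ℕ) < s then weightedJacobiSum n α u h else (starRingEnd ℂ) (weightedJacobiSum n α u h) := by
      intro i
      split_ifs
      · rfl
      · exact hconj.symm
    rw [Finset.prod_congr rfl fun i _ => h2 i, Fin.prod_univ_eq_prod_range
      (fun i => if i < s then weightedJacobiSum n α u h else (starRingEnd ℂ) (weightedJacobiSum n α u h)),
      two_mul, Finset.prod_range_add]
    rw [Finset.prod_congr rfl fun i hi => if_pos (Finset.mem_range.1 hi)]
    simp only [add_lt_iff_neg_left, not_lt_zero, if_false, Finset.prod_const, Finset.card_range]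
    rw [← mul_pow, Complex.mul_conj, Complex.normSq_eq_norm_sq, ← two_mul, pow_mul]
    push_cast
    rfl
  rw [h1, Finset.prod_univ_sum]
  refine Finset.sum_congr rfl fun t _ => ?_
  rw [Finset.prod_mul_distrib, tupleCoeff, jacobiSym_prod]
  push_cast
  rfl

theorem legendreSum_eq_weightedJacobiSum (p : ℕ) [Fact p.Prime] (α : ℕ → ℂ) (u h : ℕ) :
    legendreSum p α u h = weightedJacobiSum p α u h :=
  Finset.sum_congr rfl fun m _ => by rw [jacobiSym.legendreSym.to_jacobiSym]

section Moment

variable {s h u : ℕ} {X : ℝ} {α : ℕ → ℂ}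

theorem hasSum_oddWeight_mul_norm_pow (hX : 0 < X) (s h u : ℕ) (α : ℕ → ℂ) :
    HasSum (fun n => ((oddWeight X n * ‖weightedJacobiSum n α u h‖ ^ (2 * s) : ℝ) : ℂ))
      (∑ t ∈ Fintype.piFinset fun _ : Fin (2 * s) => Finset.Ioc u (u + h),
        tupleCoeff s α t * ∑' n, (oddWeight X n : ℂ) * jacobiSym ((∏ i, t i : ℕ) : ℤ) n) := by
  have h1 := hasSum_sum (s := Fintype.piFinset fun _ : Fin (2 * s) => Finset.Ioc u (u + h))
    fun t _ => (summable_oddWeight_mul_jacobiSym hX ((∏ i, t i : ℕ) : ℤ)).hasSum.mul_left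
      (tupleCoeff s α t)
  refine (funext fun n => ?_ : (fun n => ((oddWeight X n * ‖weightedJacobiSum n α u h‖ ^ (2 * s) : ℝ) : ℂ)) = _) ▸ h1
  rw [Complex.ofReal_mul, norm_weightedJacobiSum_pow, Finset.mul_sum]
  exact Finset.sum_congr rfl fun t _ => mul_left_comm _ _ _

theorem tsum_oddWeight_mul_norm_pow_le (hX : 0 < X) {D E : ℝ} (hE : 0 ≤ E)
    (hα : ∀ n ∈ Finset.Ioc u (u + h), ‖α n‖ ≤ 1)
    (hsq : ∀ a : ℤ, ‖∑' n, (oddWeight X n : ℂ) * jacobiSym a n‖ ≤ D)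
    (hns : ∀ N : ℕ, N ≠ 0 → N ≤ (u + h) ^ (2 * s) → ¬ IsSquare N →
      ‖∑' n, (oddWeight X n : ℂ) * jacobiSym N n‖ ≤ E) :
    ∑' n, oddWeight X n * ‖weightedJacobiSum n α u h‖ ^ (2 * s) ≤
      squareTuples (2 * s) h u * D + h ^ (2 * s) * E := by
  set P := Fintype.piFinset fun _ : Fin (2 * s) => Finset.Ioc u (u + h) with hP
  have h1 := (hasSum_oddWeight_mul_norm_pow hX s h u α).tsum_eq
  rw [← Complex.ofReal_tsum] at h1
  have h2 : ∑' n, oddWeight X n * ‖weightedJacobiSum n α u h‖ ^ (2 * s) ≤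
      -- Charging $E$ to square tuples as well is harmless and makes the second term exactly
      -- $h^{2s}E$.
      ∑ t ∈ P, ((if IsSquare (∏ i, t i) then D else 0) + E) := by
    refine (Complex.re_le_norm _).trans' (le_of_eq (Complex.ofReal_re _).symm) |>.trans ?_
    rw [h1]
    refine norm_sum_le_of_le _ fun t ht => ?_
    have hti : ∀ i, t i ∈ Finset.Ioc u (u + h) := Fintype.mem_piFinset.1 ht
    rw [norm_mul]
    refine (mul_le_of_le_one_left (norm_nonneg _)
      (norm_tupleCoeff_le_one fun i => hα _ (hti i))).trans ?_
    split_ifs with hs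
    · linarith [hsq ((∏ i, t i : ℕ) : ℤ)]
    · rw [zero_add]
      refine hns _ ?_ ?_ hs
      · exact Finset.prod_ne_zero_iff.2 fun i _ => by have := Finset.mem_Ioc.1 (hti i); omega
      · refine (Finset.prod_le_pow_card _ _ _ fun i _ => (Finset.mem_Ioc.1 (hti i)).2).trans ?_
        simp
  refine h2.trans (le_of_eq ?_)
  rw [Finset.sum_add_distrib, ← Finset.sum_filter, Finset.sum_const, Finset.sum_const,
    squareTuples, nsmul_eq_mul, nsmul_eq_mul, hP, Fintype.card_piFinset_const]
  simp

/-- Each prime of $[X,2X]$ is odd and carries weight at least $e^{-1/2}\log X$; all other terms are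
nonnegative and are added for free. -/
theorem legendreMoment_mul_log_le (hX : 2 < X) (s h u : ℕ) (α : ℕ → ℂ) :
    legendreMoment (2 * s) X α u h * (Real.exp (-1 / 2) * Real.log X) ≤
      ∑' n, oddWeight X n * ‖weightedJacobiSum n α u h‖ ^ (2 * s) := by
  have hX0 : 0 < X := by linarith
  have hsum : Summable fun n => oddWeight X n * ‖weightedJacobiSum n α u h‖ ^ (2 * s) :=
    Complex.summable_ofReal.1 (hasSum_oddWeight_mul_norm_pow hX0 s h u α).summable
  rw [legendreMoment, Finset.sum_mul]
  calc _ ≤ ∑ p ∈ dyadicPrimes X, oddWeight X p * ‖weightedJacobiSum p α u h‖ ^ (2 * s) := by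
        refine Finset.sum_le_sum fun p hp => ?_
        obtain ⟨h1, h2⟩ := mem_dyadicPrimes.1 hp
        have : Fact (p : ℕ).Prime := ⟨p.2⟩
        have hodd : Odd (p : ℕ) := p.2.odd_of_ne_two fun hp2 => by
          rw [hp2] at h1
          norm_num at h1
          linarith
        rw [legendreSum_eq_weightedJacobiSum, mul_comm, oddWeight, if_pos hodd,
          ArithmeticFunction.vonMangoldt_apply_prime p.2, mul_comm (Real.exp _)]
        have h3 := Real.log_le_log hX0 h1
        have h4 := exp_neg_le_logGaussWeight hX0 h1 h2
        have h5 : 0 ≤ Real.log X := Real.log_nonneg (by linarith)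
        gcongr
    _ = ∑ n ∈ (dyadicPrimes X).map (Function.Embedding.subtype _),
          oddWeight X n * ‖weightedJacobiSum n α u h‖ ^ (2 * s) := by
        rw [Finset.sum_map]; rfl
    _ ≤ _ := hsum.sum_le_tsum _ fun n _ => mul_nonneg (oddWeight_nonneg X n) (by positivity)

end Moment

/-! ### The final bound and the $o(1)$ exponents -/

/-- The order of quantifiers matters: $K$ precedes $\varepsilon$ and can be absorbed in $h^{o(1)}$,
while $A$ depends on $\varepsilon$ and goes into $Q^{o(1)}$. -/
theorem exists_legendreMoment_le (s : ℕ) : ∃ K : ℝ, 1 ≤ K ∧ (GRH → ∀ ε : ℝ, 0 < ε → ε ≤ 1 →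
    ∃ A : ℝ, 1 ≤ A ∧ ∀ (h u : ℕ) (Q : ℝ) (α : ℕ → ℂ), 2 ≤ h → h < u → (u : ℝ) ≤ Q →
      (∀ n ∈ Finset.Ioc u (u + h), ‖α n‖ ≤ 1) →
      legendreMoment (2 * s) Q α u h ≤
        K * squareTuples (2 * s) h u * (Nat.primeCounting ⌊Q⌋₊ : ℝ) +
          (h : ℝ) ^ (2 * s) * (A * Q ^ (1 / 2 + ε))) := by
  obtain ⟨D, hD0, hD⟩ := exists_tsum_vonMangoldt_mul_logGaussWeight_le
  obtain ⟨B, hB0, hB⟩ := exists_le_primeCounting_mul_log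
  refine ⟨1 + Real.exp (1 / 2) * D * B, by simp; positivity, fun hGRH ε hε hε1 => ?_⟩
  obtain ⟨A, hA0, hA⟩ := hGRH.exists_norm_tsum_oddWeight_mul_jacobiSym_le hε hε1
  -- Since $N\le(2Q)^{2s}$ and $\log Q\ge1$, $1+\log(4N)\le c\log Q$.
  set c : ℝ := 1 + Real.log 4 + 2 * s * Real.log 2 + 2 * s with hc
  have hl4 := Real.log_nonneg (by norm_num : (1 : ℝ) ≤ 4)
  have hl2 := Real.log_nonneg (by norm_num : (1 : ℝ) ≤ 2)
  have hc0 : 0 ≤ c := by positivity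
  refine ⟨1 + Real.exp (1 / 2) * A * c, by simp; positivity, ?_⟩
  intro h u Q α h2 hu hQ hα
  have hQ3 : 3 ≤ Q := le_trans (by exact_mod_cast (by omega : 3 ≤ u)) hQ
  have hQ0 : 0 < Q := by linarith
  have hlQ : 1 ≤ Real.log Q := by
    rw [Real.le_log_iff_exp_le hQ0]
    linarith [Real.exp_one_lt_d9]
  have hlQ0 : 0 < Real.log Q := by linarith
  have hE : ∀ N : ℕ, N ≠ 0 → N ≤ (u + h) ^ (2 * s) → ¬ IsSquare N →
      ‖∑' n, (oddWeight Q n : ℂ) * jacobiSym N n‖ ≤ A * (c * Real.log Q) * Q ^ (1 / 2 + ε) := by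
    intro N hN hNle hsq
    refine (hA N hN hsq Q hQ0).trans ?_
    have hN0 : (0 : ℝ) < N := by exact_mod_cast Nat.pos_of_ne_zero hN
    have h1 : (N : ℝ) ≤ (2 * Q) ^ (2 * s) := by
      have e1 : ((u + h : ℕ) : ℝ) ≤ 2 * Q := by
        have : ((u + h : ℕ) : ℝ) ≤ ((2 * u : ℕ) : ℝ) := by exact_mod_cast (by omega)
        push_cast at this ⊢
        linarith
      calc (N : ℝ) ≤ ((u + h : ℕ) : ℝ) ^ (2 * s) := by exact_mod_cast hNle
        _ ≤ _ := by gcongr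
    have h2 : Real.log (4 * N) ≤ Real.log 4 + 2 * s * (Real.log 2 + Real.log Q) := by
      rw [Real.log_mul (by norm_num) hN0.ne', ← Real.log_mul two_ne_zero hQ0.ne']
      have := Real.log_le_log hN0 h1
      rw [Real.log_pow] at this
      push_cast at this
      linarith
    have h3 : 1 + Real.log (4 * N) ≤ c * Real.log Q := by
      have e1 : 0 ≤ 2 * s * Real.log 2 := by positivity
      rw [hc]
      nlinarith
    gcongr
  have hmain := (legendreMoment_mul_log_le (by linarith : 2 < Q) s h u α).trans
    (tsum_oddWeight_mul_norm_pow_le hQ0 (D := D * Q)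
      (E := A * (c * Real.log Q) * Q ^ (1 / 2 + ε)) (by positivity) hα
      (fun a => (norm_tsum_oddWeight_mul_jacobiSym_le hQ0 a).trans (hD Q (by linarith))) hE)
  set R : ℝ := (squareTuples (2 * s) h u : ℝ) with hR
  have hR0 : 0 ≤ R := Nat.cast_nonneg _
  have hπ := hB Q (by linarith)
  set π : ℝ := (Nat.primeCounting ⌊Q⌋₊ : ℝ) with hπdef
  have hπ0 : 0 ≤ π := Nat.cast_nonneg _
  have he : Real.exp (1 / 2) * Real.exp (-1 / 2) = 1 := by
    rw [← Real.exp_add]; norm_num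
  have h3 : legendreMoment (2 * s) Q α u h * Real.log Q ≤
      (Real.exp (1 / 2) * D * B * R * π +
        h ^ (2 * s) * (Real.exp (1 / 2) * A * c * Q ^ (1 / 2 + ε))) * Real.log Q := by
    calc _ = Real.exp (1 / 2) * (legendreMoment (2 * s) Q α u h *
          (Real.exp (-1 / 2) * Real.log Q)) := by
          linear_combination (-(legendreMoment (2 * s) Q α u h * Real.log Q)) * he
      _ ≤ Real.exp (1 / 2) * (R * (D * (B * (π * Real.log Q))) +
          h ^ (2 * s) * (A * (c * Real.log Q) * Q ^ (1 / 2 + ε))) := by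
          refine mul_le_mul_of_nonneg_left (hmain.trans ?_) (Real.exp_pos _).le
          gcongr
      _ = _ := by ring
  refine (le_of_mul_le_mul_right h3 hlQ0).trans ?_
  have e1 : 0 ≤ R * π := by positivity
  have e2 : 0 ≤ (h : ℝ) ^ (2 * s) * Q ^ (1 / 2 + ε) := by positivity
  linarith [e1, e2]

/-- A bound by `A k * Q ^ (1 / (k + 1))` for every `k` is a bound by `Q ^ o(1)`. -/
theorem exists_tendsto_zero_le_rpow (A : ℕ → ℝ) (hA : ∀ k, 1 ≤ A k) :
    ∃ η : ℝ → ℝ, Tendsto η atTop (𝓝 0) ∧ ∀ Q : ℝ, 1 < Q → ∀ y : ℝ,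
      (∀ k : ℕ, y ≤ A k * Q ^ (1 / 2 + 1 / ((k : ℝ) + 1))) → y ≤ Q ^ (1 / 2 + η Q) := by
  set T : ℝ → ℕ → ℝ := fun Q k => 1 / ((k : ℝ) + 1) + Real.log (A k) / Real.log Q with hT
  have hT0 : ∀ Q, 1 < Q → ∀ k, 0 ≤ T Q k := fun Q hQ k =>
    add_nonneg (by positivity) (div_nonneg (Real.log_nonneg (hA k)) (Real.log_pos hQ).le)
  -- The $k$-th bound reads $y\le Q^{1/2+T(Q,k)}$, so the infimum over $k$ is the best exponent; it
  -- depends on $Q$ alone.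
  refine ⟨fun Q => ⨅ k, T Q k, ?_, fun Q hQ y hy => ?_⟩
  · rw [Metric.tendsto_nhds]
    intro ε hε
    obtain ⟨k, hk⟩ := exists_nat_one_div_lt (half_pos hε)
    have hlim : Tendsto (fun Q => Real.log (A k) / Real.log Q) atTop (𝓝 0) :=
      tendsto_const_nhds.div_atTop Real.tendsto_log_atTop
    filter_upwards [hlim.eventually (gt_mem_nhds (half_pos hε)), eventually_gt_atTop 1] with Q h1 hQ
    have h2 : ⨅ k, T Q k ≤ T Q k :=
      ciInf_le ⟨0, by rintro _ ⟨k, rfl⟩; exact hT0 Q hQ k⟩ k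
    rw [Real.dist_0_eq_abs, abs_of_nonneg (Real.iInf_nonneg (hT0 Q hQ))]
    exact h2.trans_lt (by simp only [hT]; linarith)
  · have hQ0 : 0 < Q := one_pos.trans hQ
    have hl := Real.log_pos hQ
    rcases le_or_gt y 0 with hy0 | hy0
    · exact hy0.trans (Real.rpow_pos_of_pos hQ0 _).le
    have h1 : Real.log y / Real.log Q - 1 / 2 ≤ ⨅ k, T Q k := by
      refine le_ciInf fun k => ?_
      have hAk : 0 < A k := one_pos.trans_le (hA k)
      have h2 := Real.log_le_log hy0 (hy k)
      rw [Real.log_mul hAk.ne' (Real.rpow_pos_of_pos hQ0 _).ne', Real.log_rpow hQ0] at h2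
      simp only [hT]
      rw [sub_le_iff_le_add, div_le_iff₀ hl]
      have h3 : Real.log (A k) / Real.log Q * Real.log Q = Real.log (A k) :=
        div_mul_cancel₀ _ hl.ne'
      linarith
    rw [← Real.log_le_log_iff hy0 (Real.rpow_pos_of_pos hQ0 _), Real.log_rpow hQ0,
      ← div_le_iff₀ hl]
    linarith

theorem momentBound_of_squareProductConjecture {s : ℕ} (hs : SquareProductConjecture s)
    (hGRH : GRH) : MomentBound s := by
  obtain ⟨δ, hδ, hsq⟩ := hs
  obtain ⟨K, hK, hbound⟩ := exists_legendreMoment_le s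
  choose A hA1 hA using fun k : ℕ => hbound hGRH (1 / ((k : ℝ) + 1)) (by positivity)
    (by rw [div_le_one (by positivity)]; linarith [(Nat.cast_nonneg k : (0 : ℝ) ≤ k)])
  obtain ⟨η, hη, hη'⟩ := exists_tendsto_zero_le_rpow A hA1
  -- The extra term absorbs the constant: $K=h^{\log K/\log h}$.
  refine ⟨fun h => δ h + Real.log K / Real.log h, η, ?_, hη, ?_⟩
  · have : Tendsto (fun h : ℕ => Real.log K / Real.log h) atTop (𝓝 0) :=
      tendsto_const_nhds.div_atTop (Real.tendsto_log_atTop.comp tendsto_natCast_atTop_atTop)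
    simpa using hδ.add this
  intro h u Q α h2 hu hQ hα
  have hQ1 : 1 < Q := lt_of_lt_of_le (by exact_mod_cast (by omega : 1 < u)) hQ
  have hh : (2 : ℝ) ≤ h := by exact_mod_cast h2
  have hl : 0 < Real.log h := Real.log_pos (by linarith)
  have hH : 0 < (h : ℝ) ^ (2 * s) := by positivity
  set X := K * squareTuples (2 * s) h u * (Nat.primeCounting ⌊Q⌋₊ : ℝ) with hX
  -- Normalising the excess over the diagonal term leaves a bound in $Q$ alone, so one $\eta$ serves
  -- all $h$, $u$ and $\alpha$.
  have h1 : (legendreMoment (2 * s) Q α u h - X) / (h : ℝ) ^ (2 * s) ≤ Q ^ (1 / 2 + η Q) := by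
    refine hη' Q hQ1 _ fun k => ?_
    rw [div_le_iff₀ hH]
    linarith [hA k h u Q α h2 hu hQ hα]
  rw [div_le_iff₀ hH] at h1
  have h3 : X ≤ (h : ℝ) ^ ((s : ℝ) + (δ h + Real.log K / Real.log h)) *
      (Nat.primeCounting ⌊Q⌋₊ : ℝ) := by
    have h4 : (h : ℝ) ^ ((s : ℝ) + (δ h + Real.log K / Real.log h)) =
        K * (h : ℝ) ^ ((s : ℝ) + δ h) := by
      rw [← add_assoc, Real.rpow_add (by linarith), mul_comm]
      congr 1
      rw [Real.rpow_def_of_pos (by linarith : (0 : ℝ) < h), mul_div_cancel₀ _ hl.ne',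
        Real.exp_log (by linarith)]
    rw [h4, hX]
    have := hsq h u h2 hu
    gcongr
  linarith

theorem theorem2 :
    (∀ s : ℕ, 1 ≤ s → SquareProductConjecture s → GRH → MomentBound s) ∧
      SquareProductConjecture 1 ∧ (GRH → MomentBound 1) :=
  ⟨fun _ _ hs hGRH => momentBound_of_squareProductConjecture hs hGRH,
    squareProductConjecture_one,
    fun hGRH => momentBound_of_squareProductConjecture squareProductConjecture_one hGRH⟩
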